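/- **Setting.** Let $k\ge 1$, $n_i\ge 1$, $m_i\ge 1$ ($1\le i\le k$) be integers, and let $\mathbb F_{n_i}^+$ be the free monoid on generators $g^i_1,\dots,g^i_{n_i}$ with identity $g^i_0$ and word length $|\cdot|$. Let $f_i=\sum_{\alpha\in\mathbb F_{n_i}^+}a_{i,\alpha}Z_{i,\alpha}$ be positive regular free holomorphic functions, i.e. formal power series in noncommuting indeterminates $Z_{i,1},\dots,Z_{i,n_i}$ with $a_{i,\alpha}\ge 0$, $a_{i,g^i_0}=0$, $a_{i,g^i_j}>0$ for all $j$, and $\limsup_{p\to\infty}\big(\sum_{|\alpha|=p}|a_{i,\alpha}|^2\big)^{1/2p}<\infty$. Let $\mathcal Q$ be a set of polynomials in the indeterminates $\{Z_{i,j}\}$, where $Z_{s,i}$ and $Z_{t,j}$ commute if $s\ne t$ and are free otherwise. *Operators on $\mathcal H$.* Let $\mathcal H$ be a complex Hilbert space and let $\mathbf A=(A_1,\dots,A_k)$, $A_i=(A_{i,1},\dots,A_{i,n_i})\in B(\mathcal H)^{n_i}$, be such that the entries of $A_s$ commute with those of $A_t$ for $s\neq t$, each series $\sum_{\alpha}a_{i,\alpha}A_{i,\alpha}A_{i,\alpha}^*$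 converges in the weak operator topology (here $A_{i,\alpha}=A_{i,j_1}\cdots A_{i,j_p}$ if $\alpha=g^i_{j_1}\cdots g^i_{j_p}$), and $q(\mathbf A)=0$ for all $q\in\mathcal Q$. Put $\Phi_{f_i,A_i}(X)=\sum_{\alpha}a_{i,\alpha}A_{i,\alpha}XA_{i,\alpha}^*$ for $X\in B(\mathcal H)$ (weak operator convergence), and $$\mathcal C_{\ge}(\mathbf\Delta^{\mathbf m}_{\mathbf f,\mathbf A})^+=\{X\ge 0:\ (id-\Phi_{f_1,A_1})^{p_1}\circ\cdots\circ(id-\Phi_{f_k,A_k})^{p_k}(X)\ge 0\ \text{ whenever } 0\le p_i\le m_i,\ 1\le i\le k\}.$$ *The universal model.* Let $F^2(H_{n_i})$ be the full Fock space with orthonormal basis $\{e^i_\alpha\}_{\alpha\in\mathbb F_{n_i}^+}$. Put $b_{i,g^i_0}^{(m_i)}=1$ and, for $|\alpha|\ge1$, $$b^{(m_i)}_{i,\alpha}=\sum_{p=1}^{|\alpha|}\ \sum_{\gamma_1\cdots\gamma_p=\alpha,\ |\gamma_1|,\dots,|\gamma_p|\ge 1}a_{i,\gamma_1}\cdots a_{i,\gamma_p}\binom{p+m_i-1}{m_i-1}.$$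 Let $W_{i,j}e^i_\alpha=\sqrt{b^{(m_i)}_{i,\alpha}/b^{(m_i)}_{i,g^i_j\alpha}}\;e^i_{g^i_j\alpha}$, and let $\mathbf W_{i,j}=I\otimes\cdots\otimes W_{i,j}\otimes\cdots\otimes I$ (with $W_{i,j}$ in position $i$) on $F^2(H_{n_1})\otimes\cdots\otimes F^2(H_{n_k})$. For $(\alpha)=(\alpha_1,\dots,\alpha_k)\in\mathbb F_{n_1}^+\times\cdots\times\mathbb F_{n_k}^+$ put $\mathbf W_{(\alpha)}=\mathbf W_{1,\alpha_1}\cdots\mathbf W_{k,\alpha_k}$. Let $\mathcal M_{\mathcal Q}$ be the closed linear span of the vectors $\mathbf W_{(\alpha)}q(\mathbf W)\mathbf W_{(\beta)}1$ with $q\in\mathcal Q$ and $(\alpha),(\beta)\in\mathbb F_{n_1}^+\times\cdots\times\mathbb F_{n_k}^+$, where $1=e^1_{g^1_0}\otimes\cdots\otimes e^k_{g^k_0}$; let $\mathcal N_{\mathcal Q}=\mathcal M_{\mathcal Q}^{\perp}$ and $\mathbf S_{i,j}=P_{\mathcal N_{\mathcal Q}}\mathbf W_{i,j}|_{\mathcal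 N_{\mathcal Q}}$. **Theorem.** The following statements are equivalent. (i) There are a closed subspace $\mathcal G\subseteq\mathcal N_{\mathcal Q}\otimes\mathcal H$ invariant under every $\mathbf S_{i,j}^*\otimes I_{\mathcal H}$ and a bounded invertible operator $Y:\mathcal H\to\mathcal G$ (with bounded inverse) such that $A_{i,j}^*=Y^{-1}[(\mathbf S_{i,j}^*\otimes I_{\mathcal H})|_{\mathcal G}]Y$ for all $i,j$. (ii) There is an invertible operator $Q\in\mathcal C_{\ge}(\mathbf\Delta^{\mathbf m}_{\mathbf f,\mathbf A})^+$ such that $\Phi_{f_i,A_i}^s(Q)\to0$ in the weak operator topology as $s\to\infty$, for each $i$. (iii) There are constants $0<a\le b$ and a positive operator $R\in B(\mathcal H)$ such that the series below converges in the weak operator topology and $$aI\le\sum_{(s_1,\dots,s_k)\in\mathbb Z_+^k}\binom{s_1+m_1-1}{m_1-1}\cdots\binom{s_k+m_k-1}{m_k-1}\Phi_{f_1,A_1}^{s_1}\circ\cdots\circ\Phi_{f_k,A_k}^{s_k}(R)\le bI .$$ Moreover, whenever $a$, $b$, $R$ are as in (iii), the subspace $\mathcal G$ and the operator $Y$ in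 (i) can be chosen so that $\|Y\|\,\|Y^{-1}\|\le\sqrt{b/a}$. -/

import Mathlib

open Filter Topology
open scoped TensorProduct InnerProductSpace ENNReal

noncomputable section

namespace NCVariety

/-! ### Positive regular free holomorphic functions -/

/-- A positive regular free holomorphic function `f = ∑ a_α Z_α` in `n` noncommuting
indeterminates, given by its coefficients `a_α`, where `α` runs over the free monoid. The sum in
the last condition runs over the words of length `p`. -/
structure PosRegular (n : ℕ) where
  coeff : FreeMonoid (Fin n) → ℝ
  coeff_nonneg : ∀ α, 0 ≤ coeff α
  coeff_one : coeff 1 = 0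
  coeff_of_pos : ∀ j, 0 < coeff (FreeMonoid.of j)
  limsup_lt_top :
    limsup (fun p : ℕ => ENNReal.ofReal
      ((∑ w : Fin p → Fin n, coeff (FreeMonoid.ofList (List.ofFn w)) ^ 2) ^ (1 / (2 * (p : ℝ)))))
      atTop < ⊤

/-- The coefficient `b_α^{(m)} = ∑_p ∑ a_{γ_1} ⋯ a_{γ_p} C(p + m - 1, m - 1)`, the inner sum being
over all factorizations `α = γ_1 ⋯ γ_p` into nonempty words. Such factorizations correspond to the
compositions `c` of the length of `α`, with `p = c.length`; the empty word has only the empty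
factorization, which gives `b_1 = 1`. -/
def PosRegular.b {n : ℕ} (f : PosRegular n) (m : ℕ) (α : FreeMonoid (Fin n)) : ℝ :=
  ∑ c : Composition α.toList.length,
    (((α.toList.splitWrtComposition c).map fun γ => f.coeff (FreeMonoid.ofList γ)).prod) *
      ((c.length + m - 1).choose (m - 1) : ℝ)

/-! ### Tuples of operators, words and polynomials -/

section Words

variable {k : ℕ} {n : Fin k → ℕ}
variable {K : Type*} [NormedAddCommGroup K] [InnerProductSpace ℂ K]

/-- `A_α = A_{j_1} ⋯ A_{j_p}` for a word `α = g_{j_1} ⋯ g_{j_p}`. -/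
def wordOp {l : ℕ} (A : Fin l → K →L[ℂ] K) (α : FreeMonoid (Fin l)) : K →L[ℂ] K :=
  FreeMonoid.lift A α

/-- `A_{(α)} = A_{1,α_1} ⋯ A_{k,α_k}` for a tuple `(α) = (α_1, …, α_k)` of words. -/
def multiWordOp (A : ∀ i, Fin (n i) → K →L[ℂ] K) (α : ∀ i, FreeMonoid (Fin (n i))) :
    K →L[ℂ] K :=
  (List.ofFn fun i => wordOp (A i) (α i)).prod

variable (n) in
/-- The algebra `ℂ⟨Z_{i,j}⟩` of polynomials in indeterminates `Z_{i,j}`, where `Z_{s,i}` and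
`Z_{t,j}` commute if `s ≠ t` and are free of relations otherwise. The monomials are
`Z_{1,α_1} ⋯ Z_{k,α_k}`, i.e. they form the product of the free monoids. -/
abbrev NCPoly : Type := MonoidAlgebra ℂ (∀ i, FreeMonoid (Fin (n i)))

/-- The value `q(A)` of a polynomial at a tuple of operators. -/
def polyEval (q : NCPoly n) (A : ∀ i, Fin (n i) → K →L[ℂ] K) : K →L[ℂ] K :=
  q.coeff.sum fun α c => c • multiWordOp A α

/-- The entries of `A_p` commute with the entries of `A_q` whenever `p ≠ q`. -/
def IsCommutingTuple (A : ∀ i, Fin (n i) → K →L[ℂ] K) : Prop :=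
  ∀ p q, p ≠ q → ∀ s t, Commute (A p s) (A q t)

end Words

/-! ### The maps `Φ_{f,A}`, defect maps and cones -/

section Maps

variable {H : Type*} [NormedAddCommGroup H] [InnerProductSpace ℂ H] [CompleteSpace H]

/-- The terms `a_α A_α X A_α^*`, as elements of `B(H)` with the weak operator topology. -/
def cpTerm {l : ℕ} (f : PosRegular l) (A : Fin l → H →L[ℂ] H) (X : H →L[ℂ] H)
    (α : FreeMonoid (Fin l)) : H →WOT[ℂ] H :=
  ContinuousLinearMapWOT.ofCLM
    ((f.coeff α : ℂ) • (wordOp A α * X * ContinuousLinearMap.adjoint (wordOp A α)))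

/-- `∑ a_α A_α A_α^*` converges in the weak operator topology. -/
def IsWeaklyConvergent {l : ℕ} (f : PosRegular l) (A : Fin l → H →L[ℂ] H) : Prop :=
  Summable (cpTerm f A 1)

/-- `Φ_{f,A}(X) = ∑ a_α A_α X A_α^*`, the sum being taken in the weak operator topology. It
converges for every `X` if `IsWeaklyConvergent f A`. -/
def cpMap {l : ℕ} (f : PosRegular l) (A : Fin l → H →L[ℂ] H) (X : H →L[ℂ] H) : H →L[ℂ] H :=
  ContinuousLinearMapWOT.toCLM (∑' α, cpTerm f A X α)

/-- `φ_1^{s_1} ∘ ⋯ ∘ φ_k^{s_k}`. -/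
def iterComp {X : Type*} {k : ℕ} (φ : Fin k → X → X) (s : Fin k → ℕ) : X → X :=
  (List.ofFn fun i => (φ i)^[s i]).foldr (· ∘ ·) id

/-- `Δ_φ^p = (id - φ_1)^{p_1} ∘ ⋯ ∘ (id - φ_k)^{p_k}`. -/
def defect {k : ℕ} (φ : Fin k → (H →L[ℂ] H) → (H →L[ℂ] H)) (p : Fin k → ℕ) :
    (H →L[ℂ] H) → (H →L[ℂ] H) :=
  iterComp (fun i X => X - φ i X) p

/-- The cone `C_≥(Δ_φ^m)^+`. -/
def posCone {k : ℕ} (φ : Fin k → (H →L[ℂ] H) → (H →L[ℂ] H)) (m : Fin k → ℕ) :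
    Set (H →L[ℂ] H) :=
  {X | 0 ≤ X ∧ ∀ p : Fin k → ℕ, p ≤ m → 0 ≤ defect φ p X}

/-- `Φ_A = (Φ_{f_1,A_1}, …, Φ_{f_k,A_k})`. -/
def cpTuple {k : ℕ} {n : Fin k → ℕ} (f : ∀ i, PosRegular (n i))
    (A : ∀ i, Fin (n i) → H →L[ℂ] H) (i : Fin k) : (H →L[ℂ] H) → (H →L[ℂ] H) :=
  cpMap (f i) (A i)

/-- The series `∑_s C(s_1+m_1-1, m_1-1) ⋯ C(s_k+m_k-1, m_k-1) φ_1^{s_1} ∘ ⋯ ∘ φ_k^{s_k}(R)`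
converges in the weak operator topology, and its sum `T` satisfies `aI ≤ T ≤ bI`. -/
def SeriesBetween {k : ℕ} (φ : Fin k → (H →L[ℂ] H) → (H →L[ℂ] H)) (m : Fin k → ℕ)
    (R : H →L[ℂ] H) (a b : ℝ) : Prop :=
  ∃ T : H →L[ℂ] H,
    HasSum (fun s : Fin k → ℕ => ContinuousLinearMapWOT.ofCLM
      (((∏ i, (s i + m i - 1).choose (m i - 1) : ℕ) : ℂ) • iterComp φ s R))
      (ContinuousLinearMapWOT.ofCLM T) ∧
    (a : ℂ) • (1 : H →L[ℂ] H) ≤ T ∧ T ≤ (b : ℂ) • (1 : H →L[ℂ] H)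

end Maps

/-! ### Fock spaces and the weighted creation operators -/

section Fock

/-- The vectors `e_{σ β}` are orthonormal in `ℓ²(B)` if `σ` is injective. -/
lemma orthonormal_shift {B : Type*} [DecidableEq B] (σ : B → B) (hσ : Function.Injective σ) :
    Orthonormal ℂ (fun β => lp.single (E := fun _ : B => ℂ) 2 (σ β) (1 : ℂ)) := by
  rw [orthonormal_iff_ite]
  intro i j
  rw [lp.inner_single_left, lp.single_apply, Pi.single_apply]
  by_cases h : i = j
  · simp [h]
  · simp [h, hσ.ne h]

/-- The bounded operator on `ℓ²(B)` with `e_β ↦ c_β e_{σ β}`, for `σ` injective and `c` bounded. -/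
def weightedShift {B : Type*} [DecidableEq B] (σ : B → B) (hσ : Function.Injective σ)
    (c : B → ℝ) {C : ℝ} (hC : 0 ≤ C) (hc : ∀ β, |c β| ≤ C) :
    lp (fun _ : B => ℂ) 2 →L[ℂ] lp (fun _ : B => ℂ) 2 :=
  (orthonormal_shift σ hσ).orthogonalFamily.linearIsometry.toContinuousLinearMap ∘L
    lp.mapCLM 2 (fun β => (c β : ℂ) • ContinuousLinearMap.id ℂ ℂ) hC
      (fun β => by
        rw [norm_smul]
        simpa using hc β)

lemma weightedShift_single {B : Type*} [DecidableEq B] (σ : B → B) (hσ : Function.Injective σ)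
    (c : B → ℝ) {C : ℝ} (hC : 0 ≤ C) (hc : ∀ β, |c β| ≤ C) (β : B) :
    weightedShift σ hσ c hC hc (lp.single 2 β (1 : ℂ)) =
      (c β : ℂ) • lp.single 2 (σ β) (1 : ℂ) := by
  have h : lp.mapCLM 2 (fun β => (c β : ℂ) • ContinuousLinearMap.id ℂ ℂ) hC
      (fun β => by
        rw [norm_smul]
        simpa using hc β) (lp.single 2 β (1 : ℂ)) =
      lp.single (E := fun _ : B => ℂ) 2 β (c β : ℂ) := by
    ext γ
    by_cases hγ : γ = β
    · subst hγ
      simp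
    · simp [hγ]
  rw [weightedShift, ContinuousLinearMap.comp_apply, h]
  simp only [LinearIsometry.coe_toContinuousLinearMap]
  rw [OrthogonalFamily.linearIsometry_apply_single]
  simp

/-- Adding a letter in front of a word: `a_{g_j} b_α ≤ b_{g_j α}`. -/
lemma PosRegular.b_cons {l : ℕ} (f : PosRegular l) (m : ℕ) (j : Fin l)
    (α : FreeMonoid (Fin l)) :
    f.coeff (FreeMonoid.of j) * f.b m α ≤ f.b m (FreeMonoid.of j * α) := by
  let e : Composition α.toList.length → Composition (FreeMonoid.of j * α).toList.length :=
    fun c => ⟨1 :: c.blocks, by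
      intro i hi
      rcases List.mem_cons.1 hi with h | h
      · omega
      · exact c.blocks_pos h, by
      simp [FreeMonoid.toList_mul, add_comm]⟩
  have he : Function.Injective e := by
    intro c d h
    have := congrArg Composition.blocks h
    exact Composition.ext (List.cons.inj this).2
  unfold PosRegular.b
  rw [Finset.mul_sum]
  have nonneg : ∀ L : List (List (Fin l)),
      0 ≤ (L.map fun γ => f.coeff (FreeMonoid.ofList γ)).prod := by
    intro L
    apply List.prod_nonneg
    intro x hx
    obtain ⟨γ, -, rfl⟩ := List.mem_map.1 hx
    exact f.coeff_nonneg _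
  let g : Composition (FreeMonoid.of j * α).toList.length → ℝ := fun c =>
    ((((FreeMonoid.of j * α).toList.splitWrtComposition c).map
      fun γ => f.coeff (FreeMonoid.ofList γ)).prod) * ((c.length + m - 1).choose (m - 1) : ℝ)
  have hg : ∀ c, 0 ≤ g c := fun c => mul_nonneg (nonneg _) (Nat.cast_nonneg _)
  have h1 : ∀ c : Composition α.toList.length,
      f.coeff (FreeMonoid.of j) *
        ((((α.toList.splitWrtComposition c).map fun γ => f.coeff (FreeMonoid.ofList γ)).prod) *
          ((c.length + m - 1).choose (m - 1) : ℝ)) ≤ g (e c) := by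
    intro c
    have h1 : (FreeMonoid.of j * α).toList.splitWrtComposition (e c) =
        [j] :: α.toList.splitWrtComposition c := by
      simp [List.splitWrtComposition, e, List.splitWrtCompositionAux_cons,
        FreeMonoid.toList_mul]
    have h2 : (e c).length = c.length + 1 := by simp [e, Composition.length]
    have h3 : (FreeMonoid.ofList [j] : FreeMonoid (Fin l)) = FreeMonoid.of j := rfl
    simp only [g]
    rw [h1, h2, List.map_cons, List.prod_cons, mul_assoc, h3]
    refine mul_le_mul_of_nonneg_left ?_ (f.coeff_nonneg _)
    refine mul_le_mul_of_nonneg_left ?_ (nonneg _)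
    exact_mod_cast Nat.choose_le_choose _ (by omega)
  refine (Finset.sum_le_sum fun c _ => h1 c).trans ?_
  rw [← Finset.sum_image (f := g) (g := e) he.injOn]
  exact Finset.sum_le_univ_sum_of_nonneg hg

lemma PosRegular.b_nonneg {l : ℕ} (f : PosRegular l) (m : ℕ) (α : FreeMonoid (Fin l)) :
    0 ≤ f.b m α := by
  refine Finset.sum_nonneg fun c _ => mul_nonneg (List.prod_nonneg ?_) (Nat.cast_nonneg _)
  intro x hx
  obtain ⟨γ, -, rfl⟩ := List.mem_map.1 hx
  exact f.coeff_nonneg _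

lemma PosRegular.weight_le {l : ℕ} (f : PosRegular l) (m : ℕ) (j : Fin l)
    (α : FreeMonoid (Fin l)) :
    |√(f.b m α) / √(f.b m (FreeMonoid.of j * α))| ≤ (√(f.coeff (FreeMonoid.of j)))⁻¹ := by
  have ha := f.coeff_of_pos j
  rw [abs_of_nonneg (by positivity)]
  rcases (f.b_nonneg m α).eq_or_lt with h | h
  · rw [← h]
    simp
  · have hb := f.b_cons m j α
    have hpos : 0 < f.b m (FreeMonoid.of j * α) := lt_of_lt_of_le (by positivity) hb
    rw [div_le_iff₀ (by positivity), inv_mul_eq_div, le_div_iff₀ (by positivity),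
      ← Real.sqrt_mul h.le]
    exact Real.sqrt_le_sqrt (by linarith)

variable {k : ℕ} {n : Fin k → ℕ}

instance {l : ℕ} : DecidableEq (FreeMonoid (Fin l)) :=
  inferInstanceAs (DecidableEq (List (Fin l)))

variable (n) in
/-- The Hilbert tensor product `F²(H_{n_1}) ⊗ ⋯ ⊗ F²(H_{n_k})` of full Fock spaces, described by
its orthonormal basis `e_β = e^1_{β_1} ⊗ ⋯ ⊗ e^k_{β_k}`, where `β_i` runs over the free monoid on
`n_i` generators. -/
abbrev Fock : Type := lp (fun _ : (∀ i, FreeMonoid (Fin (n i))) => ℂ) 2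

/-- The basis vector `e_β = e^1_{β_1} ⊗ ⋯ ⊗ e^k_{β_k}`. -/
def fockBasis (β : ∀ i, FreeMonoid (Fin (n i))) : Fock n := lp.single 2 β (1 : ℂ)

/-- Replace `β_i` by `g_j β_i`. -/
def consAt (i : Fin k) (j : Fin (n i)) (β : ∀ i, FreeMonoid (Fin (n i))) :
    ∀ i, FreeMonoid (Fin (n i)) :=
  Function.update β i (FreeMonoid.of j * β i)

lemma consAt_injective (i : Fin k) (j : Fin (n i)) :
    Function.Injective (consAt (n := n) i j) := by
  intro β γ h
  funext t
  have ht := congrFun h t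
  by_cases hti : t = i
  · subst hti
    simp only [consAt, Function.update_self] at ht
    exact mul_left_cancel ht
  · simpa [consAt, hti] using ht

/-- The operator `𝐖_{i,j} = I ⊗ ⋯ ⊗ W_{i,j} ⊗ ⋯ ⊗ I`, where `W_{i,j}`, in the `i`-th position, is
the weighted left creation operator `e^i_α ↦ √b_{i,α} / √b_{i,g_j α} e^i_{g_j α}`. -/
def universalW (f : ∀ i, PosRegular (n i)) (m : Fin k → ℕ) (i : Fin k) (j : Fin (n i)) :
    Fock n →L[ℂ] Fock n :=
  weightedShift (consAt i j) (consAt_injective i j)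
    (fun β => √((f i).b (m i) (β i)) / √((f i).b (m i) (FreeMonoid.of j * β i)))
    (C := (√((f i).coeff (FreeMonoid.of j)))⁻¹) (by positivity)
    (fun β => (f i).weight_le (m i) j (β i))

lemma universalW_fockBasis (f : ∀ i, PosRegular (n i)) (m : Fin k → ℕ) (i : Fin k)
    (j : Fin (n i)) (β : ∀ i, FreeMonoid (Fin (n i))) :
    universalW f m i j (fockBasis β) =
      ((√((f i).b (m i) (β i)) / √((f i).b (m i) (FreeMonoid.of j * β i)) : ℝ) : ℂ) •
        fockBasis (consAt i j β) :=
  weightedShift_single _ _ _ _ _ _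

end Fock

/-! ### The universal model of a noncommutative variety -/

section Model

variable {k : ℕ} {n : Fin k → ℕ}

/-- `M_Q`, the closed span of the vectors `W_{(α)} q(W) W_{(β)} 1`, `q ∈ Q`. -/
def spaceM (f : ∀ i, PosRegular (n i)) (m : Fin k → ℕ) (Qs : Set (NCPoly n)) :
    Submodule ℂ (Fock n) :=
  (Submodule.span ℂ {x | ∃ α β : ∀ i, FreeMonoid (Fin (n i)), ∃ q ∈ Qs,
    x = (multiWordOp (universalW f m) α * polyEval q (universalW f m) *
      multiWordOp (universalW f m) β) (fockBasis 1)}).topologicalClosure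

/-- `N_Q`, the orthogonal complement of `M_Q` in the tensor product of the Fock spaces. -/
def spaceN (f : ∀ i, PosRegular (n i)) (m : Fin k → ℕ) (Qs : Set (NCPoly n)) :
    Submodule ℂ (Fock n) :=
  (spaceM f m Qs)ᗮ

instance (f : ∀ i, PosRegular (n i)) (m : Fin k → ℕ) (Qs : Set (NCPoly n)) :
    CompleteSpace (spaceN f m Qs) :=
  inferInstanceAs (CompleteSpace (spaceM f m Qs)ᗮ)

/-- The universal model `S_{i,j} = P_{N_Q} W_{i,j} |_{N_Q}` of the variety. -/
def universalS (f : ∀ i, PosRegular (n i)) (m : Fin k → ℕ) (Qs : Set (NCPoly n))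
    (i : Fin k) (j : Fin (n i)) : spaceN f m Qs →L[ℂ] spaceN f m Qs :=
  (spaceN f m Qs).orthogonalProjectionOnto ∘L universalW f m i j ∘L (spaceN f m Qs).subtypeL

/-- The Hilbert space tensor product: the completion of the algebraic tensor product with respect
to the inner product `⟪x ⊗ h, y ⊗ g⟫ = ⟪x, y⟫ ⟪h, g⟫`. -/
def HilbertTensor (K H : Type*) [NormedAddCommGroup K] [InnerProductSpace ℂ K]
    [NormedAddCommGroup H] [InnerProductSpace ℂ H] : Type _ :=
  UniformSpace.Completion (K ⊗[ℂ] H)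

section

variable (K H : Type*) [NormedAddCommGroup K] [InnerProductSpace ℂ K]
  [NormedAddCommGroup H] [InnerProductSpace ℂ H]

instance : NormedAddCommGroup (HilbertTensor K H) :=
  inferInstanceAs (NormedAddCommGroup (UniformSpace.Completion (K ⊗[ℂ] H)))

instance : InnerProductSpace ℂ (HilbertTensor K H) :=
  inferInstanceAs (InnerProductSpace ℂ (UniformSpace.Completion (K ⊗[ℂ] H)))

instance : CompleteSpace (HilbertTensor K H) :=
  inferInstanceAs (CompleteSpace (UniformSpace.Completion (K ⊗[ℂ] H)))

/-- The isometric embedding of the algebraic tensor product into its completion. -/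
def HilbertTensor.incl : K ⊗[ℂ] H →ₗᵢ[ℂ] HilbertTensor K H :=
  UniformSpace.Completion.toComplₗᵢ

lemma HilbertTensor.denseRange_incl : DenseRange (HilbertTensor.incl K H) :=
  UniformSpace.Completion.denseRange_coe (α := K ⊗[ℂ] H)

end

/-- The operator `T ⊗ I_H` on the Hilbert space tensor product `K ⊗ H`: the continuous extension of
`x ⊗ h ↦ T x ⊗ h`. -/
def tensorId {K : Type*} (H : Type*) [NormedAddCommGroup K] [InnerProductSpace ℂ K]
    [NormedAddCommGroup H] [InnerProductSpace ℂ H] (T : K →L[ℂ] K) :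
    HilbertTensor K H →L[ℂ] HilbertTensor K H :=
  ((HilbertTensor.incl K H).toContinuousLinearMap ∘L T.rTensor H).extend
    (HilbertTensor.incl K H).toContinuousLinearMap

lemma tensorId_incl {K H : Type*} [NormedAddCommGroup K] [InnerProductSpace ℂ K]
    [NormedAddCommGroup H] [InnerProductSpace ℂ H] (T : K →L[ℂ] K) (x : K ⊗[ℂ] H) :
    tensorId H T (HilbertTensor.incl K H x) = HilbertTensor.incl K H (T.rTensor H x) :=
  ContinuousLinearMap.extend_eq _ (HilbertTensor.denseRange_incl K H)
    (HilbertTensor.incl K H).isometry.isUniformInducing x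

variable {H : Type*} [NormedAddCommGroup H] [InnerProductSpace ℂ H] [CompleteSpace H]

/-- `G ⊆ N_Q ⊗ H` is a closed subspace invariant under each `S_{i,j}^* ⊗ I_H`, and
`A_{i,j}^* = Y⁻¹ [(S_{i,j}^* ⊗ I_H)|_G] Y` for all `i`, `j`. -/
def IsSimilarToPart (f : ∀ i, PosRegular (n i)) (m : Fin k → ℕ) (Qs : Set (NCPoly n))
    (A : ∀ i, Fin (n i) → H →L[ℂ] H) (G : Submodule ℂ (HilbertTensor (spaceN f m Qs) H))
    (Y : H ≃L[ℂ] G) : Prop :=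
  IsClosed (G : Set (HilbertTensor (spaceN f m Qs) H)) ∧
  ∃ hG : ∀ i j, ∀ x ∈ G, tensorId H (ContinuousLinearMap.adjoint (universalS f m Qs i j)) x ∈ G,
    ∀ i j, ContinuousLinearMap.adjoint (A i j) =
      (Y.symm : G →L[ℂ] H) ∘L
        (tensorId H (ContinuousLinearMap.adjoint (universalS f m Qs i j))).restrict (hG i j) ∘L
          (Y : H →L[ℂ] G)

end Model

end NCVariety

end

/-!
The theorem is proved by passing from operators to quadratic forms with values in `[0, ∞]`, where
sums converge unconditionally and may be interchanged.

On forms, the map `Φ_{f_i,A_i}` becomes the operator `φ_i : q ↦ ∑_α a_{i,α} q(A_{i,α}^* ·)`, which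
commutes with arbitrary sums (`quadForm_cpMap`). Its geometric series `G_i = ∑_s φ_i^s` satisfies
`G_i = 1 + φ_i G_i`, i.e. it stands for `(1 - φ_i)^{-1}`, and the product `G_1^{m_1} ⋯ G_k^{m_k}`
(`FormOp.geomProd`) has two expansions. The binomial series gives
`∑_s ∏ C(s_i + m_i - 1, m_i - 1) φ^s` (`FormOp.geomProd_eq_sum`), which is the series in the
two-sided estimate. Since factorizations of words into nonempty words are lists of nonempty words,
it is also `q ↦ ∑_β b_β q(A_β^* ·)`, where `β` runs over tuples of words (`kernel_b`,
`geomProd_quadForm`). The equivalence of the three statements is obtained as follows.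

* From the two-sided estimate to a pure solution `Q`. If `T` is the sum of the series for `R`, then
  `(1 - Φ)^p(T)` has the form `G^{m-p} R ≥ 0` (`defect_of_geomProd`), and `Φ_i^s(T)` is the tail of
  a convergent geometric series, so `Q = T` is a solution.
* From a pure solution `Q` to the two-sided estimate. Each equation `X = X' + Φ_i(X)` between
  consecutive defects of `Q` is solved by `X = G_i X'`, so that `Q` is the sum of the series for its
  defect `R = (1 - Φ)^m(Q)` (`geomProd_defect`).
* From the two-sided estimate to similarity. For `R = S^* S` the Berezin kernel
  `V x = ∑_β √b_β e_β ⊗ S A_β^* x` satisfies `‖V x‖² = ⟪T x, x⟫`, where `T` is the sum of the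
  series. It intertwines `A_{i,j}^*` with `𝐖_{i,j}^* ⊗ I`, and since `q(A) = 0` for `q ∈ Q` its
  adjoint vanishes on `M_Q ⊗ H`, so that `V` takes values in `N_Q ⊗ H`. From `aI ≤ T ≤ bI` it
  follows that `V` is an isomorphism onto its range with the required bound on the condition number
  (`exists_isSimilarToPart`).
* From similarity to the two-sided estimate. A similarity to a part of the model, seen as a map `V`
  into the tensor product of the Fock spaces with `H`, must be a Berezin kernel: intertwining
  determines all coordinates of `V` from the vacuum coordinate, which is, up to a scalar, the
  operator `S`, and `R = S^* S` has the required property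
  (`exists_seriesBetween_of_isSimilarToPart`).
-/

open Filter Topology
open scoped TensorProduct InnerProductSpace ENNReal

noncomputable section

namespace NCVariety

/-! ### Normal operators on extended nonnegative functions -/

/-- Operators on functions `H → [0, ∞]`. A positive operator `X` on `H` is represented by its
quadratic form `h ↦ ⟪X h, h⟫`, and a completely positive map by an operator on such forms. -/
abbrev FormOp (H : Type*) : Type _ := Module.End ℝ≥0∞ (H → ℝ≥0∞)

namespace FormOp

variable {H : Type*} {X Y : Type}

/-- An operator is normal if it commutes with arbitrary sums. -/
def IsNormal (ψ : FormOp H) : Prop :=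
  ∀ (X : Type) (u : X → H → ℝ≥0∞), ψ (fun h => ∑' x, u x h) = fun h => ∑' x, ψ (u x) h

/-- The pointwise sum of a family of operators. -/
def sum (ψ : X → FormOp H) : FormOp H where
  toFun q h := ∑' x, ψ x q h
  map_add' q r := by
    funext h
    simp [ENNReal.tsum_add]
  map_smul' c q := by
    funext h
    simp [ENNReal.tsum_mul_left]

lemma sum_apply (ψ : X → FormOp H) (q : H → ℝ≥0∞) (h : H) : sum ψ q h = ∑' x, ψ x q h := rfl

/-- The weighted composition operator `q ↦ w • q ∘ τ`. -/
def point (w : ℝ≥0∞) (τ : H → H) : FormOp H where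
  toFun q h := w * q (τ h)
  map_add' q r := by
    funext h
    simp [mul_add]
  map_smul' c q := by
    funext h
    simp [mul_left_comm]

lemma point_apply (w : ℝ≥0∞) (τ : H → H) (q : H → ℝ≥0∞) (h : H) :
    point w τ q h = w * q (τ h) := rfl

lemma isNormal_point (w : ℝ≥0∞) (τ : H → H) : IsNormal (point w τ) := by
  intro X u
  funext h
  simp [point_apply, ENNReal.tsum_mul_left]

lemma isNormal_one : IsNormal (1 : FormOp H) := fun _ _ => rfl

lemma IsNormal.mul {ψ χ : FormOp H} (hψ : IsNormal ψ) (hχ : IsNormal χ) : IsNormal (ψ * χ) := by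
  intro X u
  rw [Module.End.mul_apply, hχ X, hψ X]
  rfl

lemma IsNormal.pow {ψ : FormOp H} (hψ : IsNormal ψ) (n : ℕ) : IsNormal (ψ ^ n) := by
  induction n with
  | zero => simpa using isNormal_one
  | succ n ih => rw [pow_succ]; exact ih.mul hψ

lemma IsNormal.smul {ψ : FormOp H} (hψ : IsNormal ψ) (c : ℝ≥0∞) : IsNormal (c • ψ) := by
  intro X u
  funext h
  simp [hψ X u, ENNReal.tsum_mul_left]

lemma IsNormal.sum {ψ : X → FormOp H} (hψ : ∀ x, IsNormal (ψ x)) : IsNormal (sum ψ) := by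
  intro Y u
  funext h
  simp only [sum_apply, fun x => hψ x Y u]
  exact ENNReal.tsum_comm

lemma IsNormal.mul_sum {χ : FormOp H} (hχ : IsNormal χ) (ψ : X → FormOp H) :
    χ * FormOp.sum ψ = FormOp.sum fun x => χ * ψ x :=
  LinearMap.ext fun q => hχ X fun x => ψ x q

lemma sum_mul (χ : FormOp H) (ψ : X → FormOp H) : sum ψ * χ = sum fun x => ψ x * χ := rfl

lemma sum_sum (ψ : X → Y → FormOp H) :
    (sum fun x => sum fun y => ψ x y) = sum fun p : X × Y => ψ p.1 p.2 := by
  ext q h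
  simp only [sum_apply]
  exact (ENNReal.tsum_prod (f := fun x y => ψ x y q h)).symm

lemma sum_equiv (e : X ≃ Y) (ψ : Y → FormOp H) : (sum fun x => ψ (e x)) = sum ψ := by
  ext q h
  simp only [sum_apply]
  exact e.tsum_eq fun y => ψ y q h

lemma sum_mul_sum {ψ : X → FormOp H} (hψ : ∀ x, IsNormal (ψ x)) (χ : Y → FormOp H) :
    sum ψ * sum χ = sum fun p : X × Y => ψ p.1 * χ p.2 := by
  rw [sum_mul, ← sum_sum fun x y => ψ x * χ y]
  exact congrArg sum (funext fun x => (hψ x).mul_sum χ)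

lemma monotone (ψ : FormOp H) : Monotone ψ := by
  intro q r hqr
  have : r = q + (r - q) := (add_tsub_cancel_of_le hqr).symm
  rw [this, map_add]
  exact le_self_add

/-- Expanding a product of sums of normal operators. -/
lemma prod_sum : ∀ {k : ℕ} {X : Fin k → Type} (ψ : ∀ i, X i → FormOp H)
    (_ : ∀ i x, IsNormal (ψ i x)),
    (List.ofFn fun i => sum (ψ i)).prod =
      sum fun x : ∀ i, X i => (List.ofFn fun i => ψ i (x i)).prod
  | 0, X, ψ, hψ => by
    ext q h
    simp [sum_apply]
  | k + 1, X, ψ, hψ => by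
    rw [List.ofFn_succ, List.prod_cons, prod_sum (fun i : Fin k => ψ i.succ) fun i => hψ i.succ,
      sum_mul_sum (hψ 0), ← sum_equiv (Fin.consEquiv X)]
    congr 1
    funext p
    rw [List.ofFn_succ, List.prod_cons]
    rfl

/-- The geometric series `∑ φ^s`. -/
def geom (φ : FormOp H) : FormOp H := sum fun s : ℕ => φ ^ s

lemma IsNormal.geom {φ : FormOp H} (hφ : IsNormal φ) : IsNormal (geom φ) := IsNormal.sum hφ.pow

lemma IsNormal.geom_eq {φ : FormOp H} (hφ : IsNormal φ) :
    FormOp.geom φ = 1 + φ * FormOp.geom φ := by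
  ext q h
  rw [FormOp.geom, hφ.mul_sum, sum_apply, tsum_eq_zero_add' ENNReal.summable]
  simp [sum_apply, ← pow_succ']

lemma IsNormal.commute_sum {χ : FormOp H} (hχ : IsNormal χ) {ψ : X → FormOp H}
    (h : ∀ x, Commute χ (ψ x)) : Commute χ (FormOp.sum ψ) := by
  rw [Commute, SemiconjBy, hχ.mul_sum, sum_mul]
  exact congrArg FormOp.sum (funext fun x => (h x).eq)

lemma IsNormal.commute_geom {φ χ : FormOp H} (hφ : IsNormal φ) (hχ : IsNormal χ)
    (h : Commute φ χ) : Commute (FormOp.geom φ) (FormOp.geom χ) :=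
  hφ.geom.commute_sum fun s => ((hχ.pow s).commute_sum fun t => (h.symm.pow_pow s t)).symm

/-- The binomial series `(1 - φ)^{-(m+1)} = ∑ C(s + m, m) φ^s`. -/
lemma IsNormal.geom_pow_succ {φ : FormOp H} (hφ : IsNormal φ) (m : ℕ) :
    FormOp.geom φ ^ (m + 1) = FormOp.sum fun s : ℕ => ((s + m).choose m : ℝ≥0∞) • φ ^ s := by
  induction m with
  | zero => simp [FormOp.geom]
  | succ m ih =>
    rw [pow_succ, ih, FormOp.geom, sum_mul_sum (fun s => (hφ.pow s).smul _),
      ← sum_equiv Finset.HasAntidiagonal.sigmaAntidiagonalEquivProd]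
    ext q h
    simp only [sum_apply, Finset.HasAntidiagonal.sigmaAntidiagonalEquivProd_apply]
    rw [ENNReal.tsum_sigma']
    refine tsum_congr fun n => ?_
    rw [tsum_fintype, Finset.univ_eq_attach,
      Finset.sum_attach _
        (fun p : ℕ × ℕ => ((((p.1 + m).choose m : ℝ≥0∞) • φ ^ p.1) * φ ^ p.2) q h)]
    have : ∀ p ∈ Finset.HasAntidiagonal.antidiagonal n,
        ((((p.1 + m).choose m : ℝ≥0∞) • φ ^ p.1) * φ ^ p.2) q h =
          ((p.1 + m).choose m : ℝ≥0∞) * (φ ^ n) q h := by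
      intro p hp
      rw [smul_mul_assoc, ← pow_add, Finset.HasAntidiagonal.mem_antidiagonal.1 hp]
      rfl
    rw [Finset.sum_congr rfl this, ← Finset.sum_mul,
      Finset.Nat.sum_antidiagonal_eq_sum_range_succ (fun i _ => ((i + m).choose m : ℝ≥0∞)),
      ← Nat.cast_sum, Nat.sum_range_add_choose]
    rfl

lemma IsNormal.geom_pow {φ : FormOp H} (hφ : IsNormal φ) {m : ℕ} (hm : 1 ≤ m) :
    FormOp.geom φ ^ m =
      FormOp.sum fun s : ℕ => ((s + m - 1).choose (m - 1) : ℝ≥0∞) • φ ^ s := by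
  obtain ⟨m, rfl⟩ := Nat.exists_eq_add_of_le' hm
  exact hφ.geom_pow_succ m

/-- Weighted compositions along an antimultiplicative family `τ` multiply as the words do. -/
lemma prod_point {M : Type} [Monoid M] (w : M → ℝ≥0∞) {τ : M → H → H} (h1 : τ 1 = id)
    (hτ : ∀ α β, τ (α * β) = τ β ∘ τ α) (L : List M) :
    (L.map fun α => point (w α) (τ α)).prod = point (L.map w).prod (τ L.prod) := by
  induction L with
  | nil =>
    ext q h
    simp [h1, point_apply]
  | cons α L ih =>
    ext q h
    rw [List.map_cons, List.prod_cons, Module.End.mul_apply, ih]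
    simp [point_apply, hτ, mul_assoc]

lemma prod_smul : ∀ {k : ℕ} (c : Fin k → ℝ≥0∞) (ψ : Fin k → FormOp H),
    (List.ofFn fun i => c i • ψ i).prod = (∏ i, c i) • (List.ofFn ψ).prod
  | 0, c, ψ => by simp
  | k + 1, c, ψ => by
    rw [List.ofFn_succ, List.prod_cons, prod_smul (fun i => c i.succ) (fun i => ψ i.succ),
      List.ofFn_succ, List.prod_cons, Fin.prod_univ_succ, smul_mul_smul_comm]

end FormOp

/-! ### Products over `Fin k` and words -/

/-- Multiplying the `i`-th factor of an ordered product by an element `a` that commutes with the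
factors in front of it. -/
lemma prod_ofFn_update {M : Type*} [Monoid M] : ∀ {k : ℕ} (x : Fin k → M) (i : Fin k) (a : M)
    (_ : ∀ j < i, Commute a (x j)),
    (List.ofFn (Function.update x i (a * x i))).prod = a * (List.ofFn x).prod
  | k + 1, x, i, a, h => by
    refine Fin.cases (fun h => ?_) (fun i h => ?_) i h
    · simp [List.ofFn_succ, mul_assoc]
    · have h0 := (h 0 (Fin.succ_pos i)).eq
      have := prod_ofFn_update (fun j => x j.succ) i a fun j hj =>
        h j.succ (Fin.succ_lt_succ_iff.2 hj)
      have e : (fun j : Fin k => Function.update x i.succ (a * x i.succ) j.succ) =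
          Function.update (fun j => x j.succ) i (a * x i.succ) := by
        funext j
        by_cases hj : j = i
        · subst hj; simp
        · simp [hj]
      rw [List.ofFn_succ, List.prod_cons, e, this, List.ofFn_succ, List.prod_cons,
        Function.update_of_ne (Fin.succ_ne_zero i).symm, ← mul_assoc, ← h0, mul_assoc]

/-- Induction on a multi-index, raising the entry `i` only while all the entries in front of it
vanish. -/
lemma multiIndex_induction {k : ℕ} {P : (Fin k → ℕ) → Prop} (h0 : P 0)
    (hs : ∀ s i, (∀ j < i, s j = 0) → P s → P (Function.update s i (s i + 1))) : ∀ s, P s := by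
  intro s
  induction hN : ∑ i, s i generalizing s with
  | zero =>
    have : s = 0 := funext fun i => by simpa using (Finset.sum_eq_zero_iff.1 hN) i
    exact this ▸ h0
  | succ N ih =>
    have hex : ∃ i, s i ≠ 0 := by
      by_contra! h
      simp [h] at hN
    obtain ⟨i, hi, hmin⟩ := WellFounded.has_min wellFounded_lt {i | s i ≠ 0} hex
    have e : Function.update (Function.update s i (s i - 1)) i
        (Function.update s i (s i - 1) i + 1) = s := by
      funext j
      by_cases hj : j = i
      · subst hj
        simp only [Function.update_self]
        have : s j ≠ 0 := hi
        omega
      · simp [hj]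
    rw [← e]
    refine hs _ i (fun j hj => ?_) (ih _ ?_)
    · rw [Function.update_of_ne hj.ne]
      by_contra h
      exact hmin j h hj
    · have h1 := Finset.sum_update_of_mem (Finset.mem_univ i) s (s i - 1)
      have h2 := Finset.add_sum_erase Finset.univ s (Finset.mem_univ i)
      rw [Finset.sdiff_singleton_eq_erase] at h1
      have : s i ≠ 0 := hi
      omega

variable {k : ℕ} {n : Fin k → ℕ}

/-- Induction on a tuple of words, by adding letters in front of its entries. -/
lemma multiWord_induction {P : (∀ i, FreeMonoid (Fin (n i))) → Prop} (h1 : P 1)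
    (hc : ∀ i j β, P β → P (consAt i j β)) : ∀ β, P β := by
  intro β
  induction hN : ∑ i, (β i).toList.length generalizing β with
  | zero =>
    have : β = 1 := funext fun i => by
      have := (Finset.sum_eq_zero_iff.1 hN) i (Finset.mem_univ i)
      exact List.length_eq_zero_iff.1 this
    exact this ▸ h1
  | succ N ih =>
    have hex : ∃ i, (β i).toList.length ≠ 0 := by
      by_contra! h
      simp [h] at hN
    obtain ⟨i, hi⟩ := hex
    obtain ⟨j, w, hw⟩ : ∃ (j : Fin (n i)) (w : FreeMonoid (Fin (n i))),
        β i = FreeMonoid.of j * w := by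
      cases hβ : (β i).toList with
      | nil => simp [hβ] at hi
      | cons j w => exact ⟨j, FreeMonoid.ofList w, hβ⟩
    have e : consAt i j (Function.update β i w) = β := by
      funext t
      by_cases ht : t = i
      · subst ht; simp [consAt, hw]
      · simp [consAt, ht]
    rw [← e]
    refine hc _ _ _ (ih _ ?_)
    have h2 := Finset.add_sum_erase Finset.univ (fun i => (β i).toList.length) (Finset.mem_univ i)
    have h1 := Finset.add_sum_erase Finset.univ
      (fun t => (Function.update β i w t).toList.length) (Finset.mem_univ i)
    have h3 : ∑ t ∈ Finset.univ.erase i, (Function.update β i w t).toList.length =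
        ∑ t ∈ Finset.univ.erase i, (β t).toList.length :=
      Finset.sum_congr rfl fun t ht => by rw [Function.update_of_ne (Finset.ne_of_mem_erase ht)]
    have h4 : (β i).toList.length = w.toList.length + 1 := by
      rw [hw, FreeMonoid.toList_mul]; simp [add_comm]
    simp only [Function.update_self] at h1
    omega

/-! ### The coefficients `b_α` -/

namespace FormOp

variable {H : Type*} {l : ℕ}

/-- The operator `q ↦ ∑ c_α q ∘ τ_α`, the sum being over all words `α`. -/
def kernel (c : FreeMonoid (Fin l) → ℝ) (τ : FreeMonoid (Fin l) → H → H) : FormOp H :=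
  sum fun α => point (ENNReal.ofReal (c α)) (τ α)

lemma isNormal_kernel (c : FreeMonoid (Fin l) → ℝ) (τ : FreeMonoid (Fin l) → H → H) :
    IsNormal (kernel c τ) :=
  IsNormal.sum fun _ => isNormal_point _ _

/-- The `s`-th power of `q ↦ ∑ c_α q ∘ τ_α` is a sum over the `s`-tuples of words. -/
lemma kernel_pow (c : FreeMonoid (Fin l) → ℝ) {τ : FreeMonoid (Fin l) → H → H} (h1 : τ 1 = id)
    (hτ : ∀ α β, τ (α * β) = τ β ∘ τ α) (s : ℕ) :
    kernel c τ ^ s = sum fun x : Fin s → FreeMonoid (Fin l) =>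
      point ((List.ofFn x).map fun α => ENNReal.ofReal (c α)).prod (τ (List.ofFn x).prod) := by
  have h : kernel c τ ^ s = (List.ofFn fun _ : Fin s => kernel c τ).prod := by simp
  rw [h]
  unfold kernel
  rw [prod_sum (fun (_ : Fin s) α => point (ENNReal.ofReal (c α)) (τ α))
    fun _ _ => isNormal_point _ _]
  congr 1
  funext x
  rw [← prod_point _ h1 hτ, List.map_ofFn]
  rfl

end FormOp

/-- The factorizations of words into nonempty words are the lists of nonempty words. -/
lemma tsum_factorizations {l : ℕ} (g : List (FreeMonoid (Fin l)) → ℝ≥0∞)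
    (hg : ∀ L, 1 ∈ L → g L = 0) :
    ∑' L, g L = ∑' α : FreeMonoid (Fin l), ∑ c : Composition α.toList.length,
      g ((α.toList.splitWrtComposition c).map FreeMonoid.ofList) := by
  let e : (Σ α : FreeMonoid (Fin l), Composition α.toList.length) → List (FreeMonoid (Fin l)) :=
    fun p => (p.1.toList.splitWrtComposition p.2).map FreeMonoid.ofList
  have he : Function.Injective e := by
    rintro ⟨α, c⟩ ⟨β, d⟩ h
    have h' : α.toList.splitWrtComposition c = β.toList.splitWrtComposition d :=
      List.map_injective_iff.2 FreeMonoid.ofList.injective h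
    have hαβ : α = β := by
      have := congrArg List.flatten h'
      rw [List.flatten_splitWrtComposition, List.flatten_splitWrtComposition] at this
      exact this
    subst hαβ
    have := congrArg (List.map List.length) h'
    rw [List.map_length_splitWrtComposition, List.map_length_splitWrtComposition] at this
    rw [Composition.ext this]
  have hsupp : Function.support g ⊆ Set.range e := by
    intro L hL
    have hL1 : ∀ γ ∈ L, γ ≠ 1 := fun γ hγ h => hL (hg L (h ▸ hγ))
    let M : List (List (Fin l)) := L.map FreeMonoid.toList
    let c : Composition M.flatten.length := ⟨M.map List.length, fun {i} hi => by
      obtain ⟨γ, hγ, rfl⟩ := List.mem_map.1 hi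
      obtain ⟨δ, hδ, rfl⟩ := List.mem_map.1 hγ
      exact List.length_pos_iff.2 (hL1 δ hδ), by rw [List.length_flatten]⟩
    have hM : M.map FreeMonoid.ofList = L := by
      rw [List.map_map]
      exact List.map_id _
    exact ⟨⟨FreeMonoid.ofList M.flatten, c⟩,
      (congrArg (List.map FreeMonoid.ofList) (List.splitWrtComposition_flatten M c rfl)).trans hM⟩
  rw [← he.tsum_eq hsupp, ENNReal.tsum_sigma']
  exact tsum_congr fun α => tsum_fintype _

open FormOp in
/-- The coefficients `b_α^{(m)}` are those of `(1 - f)^{-m}`: summing `b_α^{(m)} q ∘ τ_α` over all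
words gives the `m`-th power of the geometric series of `q ↦ ∑ a_α q ∘ τ_α`. -/
lemma kernel_b {H : Type*} {l : ℕ} (f : PosRegular l) {m : ℕ} (hm : 1 ≤ m)
    {τ : FreeMonoid (Fin l) → H → H} (h1 : τ 1 = id) (hτ : ∀ α β, τ (α * β) = τ β ∘ τ α) :
    kernel (f.b m) τ = geom (kernel f.coeff τ) ^ m := by
  rw [(isNormal_kernel _ _).geom_pow hm]
  ext q h
  let g : List (FreeMonoid (Fin l)) → ℝ≥0∞ := fun L =>
    ((L.length + m - 1).choose (m - 1) : ℝ≥0∞) *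
      ((L.map fun α => ENNReal.ofReal (f.coeff α)).prod * q (τ L.prod h))
  have hR : FormOp.sum (fun s : ℕ => ((s + m - 1).choose (m - 1) : ℝ≥0∞) • kernel f.coeff τ ^ s)
      q h = ∑' L, g L := by
    rw [← List.equivSigmaTuple.symm.tsum_eq g, ENNReal.tsum_sigma', sum_apply]
    refine tsum_congr fun s => ?_
    rw [kernel_pow _ h1 hτ, LinearMap.smul_apply, Pi.smul_apply, sum_apply, smul_eq_mul,
      ← ENNReal.tsum_mul_left]
    refine tsum_congr fun x => ?_
    change _ = g (List.ofFn x)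
    simp only [g, List.length_ofFn, point_apply]
  have hg : ∀ L, 1 ∈ L → g L = 0 := by
    intro L hL
    have : (L.map fun α => ENNReal.ofReal (f.coeff α)).prod = 0 :=
      List.prod_eq_zero (List.mem_map.2 ⟨1, hL, by simp [f.coeff_one]⟩)
    simp only [g, this, zero_mul, mul_zero]
  rw [hR, tsum_factorizations g hg, kernel, sum_apply]
  refine tsum_congr fun α => ?_
  rw [point_apply, PosRegular.b, ENNReal.ofReal_sum_of_nonneg, Finset.sum_mul]
  · refine Finset.sum_congr rfl fun c _ => ?_
    have hprod : ∀ M : List (List (Fin l)),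
        ENNReal.ofReal ((M.map fun γ => f.coeff (FreeMonoid.ofList γ)).prod) =
          ((M.map FreeMonoid.ofList).map fun α => ENNReal.ofReal (f.coeff α)).prod := by
      intro M
      induction M with
      | nil => simp
      | cons γ M ih =>
        rw [List.map_cons, List.prod_cons, ENNReal.ofReal_mul (f.coeff_nonneg _), ih]
        simp
    have hflat : ∀ M : List (List (Fin l)),
        (M.map FreeMonoid.ofList).prod = FreeMonoid.ofList M.flatten := by
      intro M
      induction M with
      | nil => rfl
      | cons γ M ih => rw [List.map_cons, List.prod_cons, ih]; rfl
    simp only [g]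
    rw [hflat, List.flatten_splitWrtComposition, FreeMonoid.ofList_toList,
      ENNReal.ofReal_mul' (Nat.cast_nonneg _), hprod, ENNReal.ofReal_natCast, List.length_map,
      List.length_splitWrtComposition]
    ring
  · intro c _
    refine mul_nonneg (List.prod_nonneg fun x hx => ?_) (Nat.cast_nonneg _)
    obtain ⟨γ, -, rfl⟩ := List.mem_map.1 hx
    exact f.coeff_nonneg _

lemma PosRegular.b_pos {l : ℕ} (f : PosRegular l) (m : ℕ) (α : FreeMonoid (Fin l)) :
    0 < f.b m α := by
  induction α using FreeMonoid.inductionOn' with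
  | one =>
    unfold PosRegular.b
    have h : ∀ c : Composition (FreeMonoid.toList (1 : FreeMonoid (Fin l))).length,
        0 < (((FreeMonoid.toList (1 : FreeMonoid (Fin l))).splitWrtComposition c).map fun γ =>
          f.coeff (FreeMonoid.ofList γ)).prod * ((c.length + m - 1).choose (m - 1) : ℝ) := by
      intro c
      have hc : c.blocks = [] := by
        by_contra hne
        obtain ⟨i, hi⟩ := List.exists_mem_of_ne_nil _ hne
        have h1 := c.blocks_pos hi
        have h2 := List.le_sum_of_mem hi
        rw [c.blocks_sum] at h2
        simp at h2
        omega
      have hs : (FreeMonoid.toList (1 : FreeMonoid (Fin l))).splitWrtComposition c = [] :=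
        List.length_eq_zero_iff.1 (by
          rw [List.length_splitWrtComposition, Composition.length, hc]
          rfl)
      rw [hs, Composition.length, hc]
      simp
    exact Finset.sum_pos (fun c _ => h c) ⟨⟨[], by simp, by simp⟩, Finset.mem_univ _⟩
  | of_mul j α ih =>
    exact lt_of_lt_of_le (mul_pos (f.coeff_of_pos j) ih) (f.b_cons m j α)

/-! ### Quadratic forms and weak operator convergence -/

section QuadraticForm

variable {H : Type*} [NormedAddCommGroup H] [InnerProductSpace ℂ H]

/-- The quadratic form `h ↦ ⟪X h, h⟫` of a positive operator, with values in `[0, ∞]`. For other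
operators negative values are cut off. -/
def quadForm (X : H →L[ℂ] H) (h : H) : ℝ≥0∞ := ENNReal.ofReal (inner ℂ h (X h)).re

lemma quadForm_ne_top (X : H →L[ℂ] H) (h : H) : quadForm X h ≠ ⊤ := ENNReal.ofReal_ne_top

lemma nonneg_iff_inner_eq {X : H →L[ℂ] H} :
    0 ≤ X ↔ ∀ h, inner ℂ h (X h) = ((quadForm X h).toReal : ℂ) := by
  rw [ContinuousLinearMap.nonneg_iff_isPositive, ContinuousLinearMap.isPositive_iff_complex]
  refine forall_congr' fun h => ?_
  rw [← inner_conj_symm h (X h), quadForm, ← inner_conj_symm h (X h), Complex.conj_re]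
  constructor
  · rintro ⟨h1, h2⟩
    have h3 : 0 ≤ (inner ℂ (X h) h).re := h2
    rw [ENNReal.toReal_ofReal h3]
    conv_lhs => rw [← h1]
    simp
  · intro h1
    have h2 := congrArg (starRingEnd ℂ) h1
    rw [Complex.conj_conj, Complex.conj_ofReal] at h2
    rw [h2]
    simp

lemma re_inner_eq_toReal_quadForm {X : H →L[ℂ] H} (hX : 0 ≤ X) (h : H) :
    ((inner ℂ h (X h)).re) = (quadForm X h).toReal := by
  rw [nonneg_iff_inner_eq.1 hX h, Complex.ofReal_re]

lemma quadForm_add {X Y : H →L[ℂ] H} (hX : 0 ≤ X) (hY : 0 ≤ Y) :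
    quadForm (X + Y) = quadForm X + quadForm Y := by
  funext h
  rw [Pi.add_apply, quadForm, _root_.add_apply, inner_add_right, Complex.add_re,
    ENNReal.ofReal_add]
  · rfl
  · rw [re_inner_eq_toReal_quadForm hX]; exact ENNReal.toReal_nonneg
  · rw [re_inner_eq_toReal_quadForm hY]; exact ENNReal.toReal_nonneg

/-- If the forms of two positive operators differ by a nonnegative function `g`, then the operators
differ by a positive operator with form `g`. -/
lemma sub_nonneg_of_quadForm {X Y : H →L[ℂ] H} (hX : 0 ≤ X) (hY : 0 ≤ Y) {g : H → ℝ≥0∞}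
    (h : quadForm X = g + quadForm Y) : 0 ≤ X - Y ∧ quadForm (X - Y) = g := by
  have hg : ∀ x, g x ≠ ⊤ := fun x hx => quadForm_ne_top X x (by rw [h]; simp [hx])
  have key : ∀ x, inner ℂ x ((X - Y) x) = ((g x).toReal : ℂ) := by
    intro x
    rw [_root_.sub_apply, inner_sub_right, nonneg_iff_inner_eq.1 hX x,
      nonneg_iff_inner_eq.1 hY x, h, Pi.add_apply,
      ENNReal.toReal_add (hg x) (quadForm_ne_top Y x)]
    push_cast
    ring
  have key2 : quadForm (X - Y) = g := by
    funext x
    rw [quadForm, key x, Complex.ofReal_re, ENNReal.ofReal_toReal (hg x)]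
  exact ⟨nonneg_iff_inner_eq.2 (by rw [key2]; exact key), key2⟩

lemma quadForm_mono {X Y : H →L[ℂ] H} (h : X ≤ Y) : quadForm X ≤ quadForm Y := by
  intro x
  refine ENNReal.ofReal_le_ofReal ?_
  have h0 : 0 ≤ Y - X := (ContinuousLinearMap.nonneg_iff_isPositive _).2 h
  have h1 := re_inner_eq_toReal_quadForm h0 x
  rw [_root_.sub_apply, inner_sub_right, Complex.sub_re] at h1
  have := (quadForm (Y - X) x).toReal_nonneg
  linarith

lemma quadForm_smul {X : H →L[ℂ] H} {c : ℝ} (hc : 0 ≤ c) :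
    quadForm ((c : ℂ) • X) = ENNReal.ofReal c • quadForm X := by
  funext h
  simp [quadForm, ENNReal.ofReal_mul hc]

lemma smul_nonneg_ofReal {X : H →L[ℂ] H} (hX : 0 ≤ X) {c : ℝ} (hc : 0 ≤ c) :
    0 ≤ (c : ℂ) • X := by
  rw [nonneg_iff_inner_eq] at hX ⊢
  intro h
  rw [quadForm_smul hc, Pi.smul_apply, smul_eq_mul, ENNReal.toReal_mul, ENNReal.toReal_ofReal hc,
    _root_.smul_apply, inner_smul_right, hX h]
  push_cast
  rfl

lemma quadForm_one (h : H) : quadForm (1 : H →L[ℂ] H) h = ENNReal.ofReal (‖h‖ ^ 2) := by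
  rw [quadForm, one_apply_eq_self, inner_self_eq_norm_sq_to_K]
  norm_cast

lemma wot_sum_apply {ι : Type*} (s : Finset ι) (F : ι → H →WOT[ℂ] H) (x : H) :
    (∑ i ∈ s, F i) x = ∑ i ∈ s, F i x := by
  classical
  induction s using Finset.induction_on with
  | empty => simp
  | insert i s hi ih => simp [Finset.sum_insert hi, ih]

variable [CompleteSpace H]

lemma quadForm_adjoint_mul (S : H →L[ℂ] H) (h : H) :
    quadForm (ContinuousLinearMap.adjoint S * S) h = ENNReal.ofReal (‖S h‖ ^ 2) := by
  rw [quadForm, mul_apply_eq_comp, ContinuousLinearMap.adjoint_inner_right,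
    inner_self_eq_norm_sq_to_K]
  norm_cast

/-- By polarization, weak operator convergence can be tested on quadratic forms. -/
lemma tendsto_wot_of_quadratic {ι : Type*} {l : Filter ι} {F : ι → H →WOT[ℂ] H}
    {T : H →WOT[ℂ] H}
    (h : ∀ x, Tendsto (fun a => inner ℂ x (F a x)) l (𝓝 (inner ℂ x (T x)))) :
    Tendsto F l (𝓝 T) := by
  rw [ContinuousLinearMapWOT.tendsto_iff_forall_inner_apply_tendsto]
  have h' : ∀ x, Tendsto (fun a => inner ℂ (F a x) x) l (𝓝 (inner ℂ (T x) x)) := by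
    intro x
    have := (Complex.continuous_conj.tendsto _).comp (h x)
    rw [inner_conj_symm] at this
    refine this.congr fun a => ?_
    exact inner_conj_symm _ _
  intro x y
  have hp : ∀ S : H →WOT[ℂ] H, inner ℂ y (S x) = starRingEnd ℂ
      ((inner ℂ (S (y + x)) (y + x) - inner ℂ (S (y - x)) (y - x) +
        Complex.I * inner ℂ (S (y + Complex.I • x)) (y + Complex.I • x) -
        Complex.I * inner ℂ (S (y - Complex.I • x)) (y - Complex.I • x)) / 4) := by
    intro S
    rw [← inner_conj_symm]
    exact congrArg _ (inner_map_polarization (ContinuousLinearMapWOT.toCLM S).toLinearMap y x)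
  rw [hp T]
  refine Tendsto.congr (fun a => (hp (F a)).symm) ?_
  refine (Complex.continuous_conj.tendsto _).comp (Tendsto.div_const ?_ _)
  exact (((h' _).sub (h' _)).add ((h' _).const_mul _)).sub ((h' _).const_mul _)

lemma hasSum_wot_of_quadratic {ι : Type*} {F : ι → H →WOT[ℂ] H} {T : H →WOT[ℂ] H}
    (h : ∀ x, HasSum (fun a => inner ℂ x (F a x)) (inner ℂ x (T x))) : HasSum F T := by
  refine tendsto_wot_of_quadratic fun x => ?_
  refine Tendsto.congr (fun s => ?_) (h x)
  rw [wot_sum_apply, inner_sum]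

lemma inner_of_hasSum_wot {ι : Type*} {F : ι → H →WOT[ℂ] H} {T : H →WOT[ℂ] H} (h : HasSum F T)
    (x y : H) : HasSum (fun a => inner ℂ y (F a x)) (inner ℂ y (T x)) := by
  have := (ContinuousLinearMapWOT.tendsto_iff_forall_inner_apply_tendsto.1 h) x y
  refine Tendsto.congr (fun s => ?_) this
  rw [wot_sum_apply, inner_sum]

/-- The sum of a weakly convergent series of positive operators is positive, and its quadratic form
is the sum of the quadratic forms. -/
lemma quadForm_hasSum {ι : Type*} {F : ι → H →L[ℂ] H} {T : H →L[ℂ] H} (hF : ∀ a, 0 ≤ F a)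
    (h : HasSum (fun a => ContinuousLinearMapWOT.ofCLM (F a)) (ContinuousLinearMapWOT.ofCLM T)) :
    0 ≤ T ∧ ∀ x, quadForm T x = ∑' a, quadForm (F a) x := by
  have h1 : ∀ x, HasSum (fun a => (quadForm (F a) x).toReal) (inner ℂ x (T x)).re := by
    intro x
    have := Complex.hasSum_re (inner_of_hasSum_wot h x x)
    refine this.congr_fun fun a => ?_
    exact (re_inner_eq_toReal_quadForm (hF a) x).symm
  have h2 : ∀ x, (inner ℂ x (T x)).im = 0 := by
    intro x
    refine (Complex.hasSum_im (inner_of_hasSum_wot h x x)).unique ?_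
    refine hasSum_zero.congr_fun fun a => ?_
    change (inner ℂ x (F a x)).im = 0
    rw [nonneg_iff_inner_eq.1 (hF a) x, Complex.ofReal_im]
  have h3 : ∀ x, 0 ≤ (inner ℂ x (T x)).re := fun x =>
    (h1 x).nonneg fun a => ENNReal.toReal_nonneg
  refine ⟨nonneg_iff_inner_eq.2 fun x => ?_, fun x => ?_⟩
  · rw [quadForm, ENNReal.toReal_ofReal (h3 x)]
    exact Complex.ext rfl (h2 x)
  · rw [quadForm, ← (h1 x).tsum_eq, ENNReal.ofReal_tsum_of_nonneg (fun a => ENNReal.toReal_nonneg)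
      (h1 x).summable]
    exact tsum_congr fun a => ENNReal.ofReal_toReal (quadForm_ne_top _ _)

/-- A series of positive operators converges weakly to a positive operator `T` as soon as the
quadratic forms sum up to that of `T`. -/
lemma hasSum_wot_of_quadForm {ι : Type*} {F : ι → H →L[ℂ] H} {T : H →L[ℂ] H}
    (hF : ∀ a, 0 ≤ F a) (hT : 0 ≤ T) (h : ∀ x, quadForm T x = ∑' a, quadForm (F a) x) :
    HasSum (fun a => ContinuousLinearMapWOT.ofCLM (F a)) (ContinuousLinearMapWOT.ofCLM T) := by
  refine hasSum_wot_of_quadratic fun x => ?_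
  change HasSum (fun a => inner ℂ x (F a x)) (inner ℂ x (T x))
  rw [nonneg_iff_inner_eq.1 hT x, funext fun a => nonneg_iff_inner_eq.1 (hF a) x]
  have hs : ∑' a, quadForm (F a) x ≠ ⊤ := h x ▸ quadForm_ne_top T x
  rw [h x, ENNReal.tsum_toReal_eq fun a => quadForm_ne_top _ _]
  exact Complex.hasSum_ofReal.2 (ENNReal.summable_toReal hs).hasSum

end QuadraticForm

/-! ### Column operators -/

section Column

lemma ofReal_norm_sq_lp {X E : Type*} [NormedAddCommGroup E] (f : lp (fun _ : X => E) 2) :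
    ENNReal.ofReal (‖f‖ ^ 2) = ∑' a, ENNReal.ofReal (‖f a‖ ^ 2) := by
  have h := lp.hasSum_norm (p := 2) (by simp) f
  simp only [ENNReal.toReal_ofNat, Real.rpow_ofNat] at h
  rw [← h.tsum_eq, ENNReal.ofReal_tsum_of_nonneg (fun a => by positivity) h.summable]

variable {H : Type*} [NormedAddCommGroup H] [InnerProductSpace ℂ H]

/-- A family of operators `C_a` with `∑ ‖C_a x‖² ≤ c ‖x‖²` forms a bounded column
`x ↦ (C_a x)_a`. -/
lemma exists_column {X : Type*} (C : X → H →L[ℂ] H) {c : ℝ} (hc : 0 ≤ c)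
    (h : ∀ x, ∑' a, ENNReal.ofReal (‖C a x‖ ^ 2) ≤ ENNReal.ofReal (c * ‖x‖ ^ 2)) :
    ∃ K : H →L[ℂ] lp (fun _ : X => H) 2, ∀ x a, K x a = C a x := by
  have hmem : ∀ x, Memℓp (fun a => C a x) 2 := by
    intro x
    refine memℓp_gen ?_
    simp only [ENNReal.toReal_ofNat, Real.rpow_ofNat]
    have hs : ∑' a, ENNReal.ofReal (‖C a x‖ ^ 2) ≠ ⊤ :=
      ((h x).trans_lt ENNReal.ofReal_lt_top).ne
    refine (ENNReal.summable_toReal hs).congr fun a => ?_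
    rw [ENNReal.toReal_ofReal (by positivity)]
  let K₀ : H →ₗ[ℂ] lp (fun _ : X => H) 2 :=
    { toFun := fun x => ⟨fun a => C a x, hmem x⟩
      map_add' := fun x y => by ext a; exact map_add _ _ _
      map_smul' := fun r x => by ext a; exact map_smul _ _ _ }
  refine ⟨K₀.mkContinuous (√c) fun x => ?_, fun x a => rfl⟩
  refine abs_le_of_sq_le_sq' ?_ (by positivity) |>.2
  rw [mul_pow, Real.sq_sqrt hc, ← ENNReal.ofReal_le_ofReal_iff (by positivity), ofReal_norm_sq_lp]
  exact h x

end Column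

/-! ### The completely positive maps `Φ_{f,A}` -/

section CpMap

variable {H : Type*} [NormedAddCommGroup H] [InnerProductSpace ℂ H]

lemma wordOp_one {l : ℕ} (A : Fin l → H →L[ℂ] H) : wordOp A 1 = 1 := map_one _

lemma wordOp_mul {l : ℕ} (A : Fin l → H →L[ℂ] H) (α β : FreeMonoid (Fin l)) :
    wordOp A (α * β) = wordOp A α * wordOp A β := map_mul _ _ _

lemma wordOp_of {l : ℕ} (A : Fin l → H →L[ℂ] H) (j : Fin l) :
    wordOp A (FreeMonoid.of j) = A j := FreeMonoid.lift_eval_of _ _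

lemma commute_wordOp {l : ℕ} {A : Fin l → H →L[ℂ] H} {B : H →L[ℂ] H}
    (h : ∀ j, Commute B (A j)) (α : FreeMonoid (Fin l)) : Commute B (wordOp A α) := by
  induction α using FreeMonoid.inductionOn' with
  | one => rw [wordOp_one]; exact Commute.one_right _
  | of_mul j α ih => rw [wordOp_mul, wordOp_of]; exact (h j).mul_right ih

variable [CompleteSpace H]

/-- The action of a word on vectors by the adjoint operator `A_α^*`. -/
def wordAdj {l : ℕ} (A : Fin l → H →L[ℂ] H) (α : FreeMonoid (Fin l)) (h : H) : H :=
  ContinuousLinearMap.adjoint (wordOp A α) h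

lemma wordAdj_one {l : ℕ} (A : Fin l → H →L[ℂ] H) : wordAdj A 1 = id := by
  funext h
  rw [wordAdj, wordOp_one, ← ContinuousLinearMap.star_eq_adjoint, star_one]
  rfl

lemma wordAdj_mul {l : ℕ} (A : Fin l → H →L[ℂ] H) (α β : FreeMonoid (Fin l)) :
    wordAdj A (α * β) = wordAdj A β ∘ wordAdj A α := by
  funext h
  rw [wordAdj, wordOp_mul, ← ContinuousLinearMap.star_eq_adjoint, star_mul]
  rfl

/-- The action of `Φ_{f,A}` on quadratic forms. -/
def cpForm {l : ℕ} (f : PosRegular l) (A : Fin l → H →L[ℂ] H) : FormOp H :=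
  FormOp.kernel f.coeff (wordAdj A)

lemma isNormal_cpForm {l : ℕ} (f : PosRegular l) (A : Fin l → H →L[ℂ] H) :
    (cpForm f A).IsNormal := FormOp.isNormal_kernel _ _

variable {l : ℕ} {f : PosRegular l} {A : Fin l → H →L[ℂ] H}

lemma inner_cpTerm (X : H →L[ℂ] H) (α : FreeMonoid (Fin l)) (x y : H) :
    inner ℂ y (cpTerm f A X α x) = f.coeff α * inner ℂ (wordAdj A α y) (X (wordAdj A α x)) := by
  change inner ℂ y ((f.coeff α : ℂ) • wordOp A α (X (wordAdj A α x))) = _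
  rw [inner_smul_right]
  exact congrArg _ (ContinuousLinearMap.adjoint_inner_left _ _ _).symm

/-- If `∑ a_α A_α A_α^*` converges weakly, then so does `∑ a_α A_α X A_α^*` for every `X`: its sum
is `K^* (X ⊕ X ⊕ ⋯) K` for the column `K` with entries `√a_α A_α^*`. -/
lemma summable_cpTerm (hA : IsWeaklyConvergent f A) (X : H →L[ℂ] H) : Summable (cpTerm f A X) := by
  obtain ⟨T, hT⟩ := hA
  have hsum : ∀ x, HasSum (fun α => ‖(√(f.coeff α) : ℂ) • wordAdj A α x‖ ^ 2)
      (inner ℂ x (T x)).re := by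
    intro x
    refine (Complex.hasSum_re (inner_of_hasSum_wot hT x x)).congr_fun fun α => ?_
    rw [inner_cpTerm, one_apply_eq_self, inner_self_eq_norm_sq_to_K, norm_smul, mul_pow]
    simp only [Complex.norm_real, Real.norm_eq_abs, sq_abs, Real.sq_sqrt (f.coeff_nonneg α)]
    rw [Complex.re_ofReal_mul]
    norm_cast
  let T' : H →L[ℂ] H := ContinuousLinearMapWOT.toCLM T
  obtain ⟨K, hK⟩ := exists_column
    (fun α => (√(f.coeff α) : ℂ) • ContinuousLinearMap.adjoint (wordOp A α))
    (norm_nonneg T') (fun x => by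
      change ∑' α, ENNReal.ofReal (‖(√(f.coeff α) : ℂ) • wordAdj A α x‖ ^ 2) ≤ _
      rw [← ENNReal.ofReal_tsum_of_nonneg (fun _ => by positivity) (hsum x).summable,
        (hsum x).tsum_eq]
      refine ENNReal.ofReal_le_ofReal ?_
      calc (inner ℂ x (T' x)).re ≤ ‖inner ℂ x (T' x)‖ := Complex.re_le_norm _
        _ ≤ ‖x‖ * ‖T' x‖ := norm_inner_le_norm _ _
        _ ≤ ‖x‖ * (‖T'‖ * ‖x‖) := by gcongr; exact T'.le_opNorm x
        _ = ‖T'‖ * ‖x‖ ^ 2 := by ring)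
  let D : lp (fun _ : FreeMonoid (Fin l) => H) 2 →L[ℂ] lp (fun _ : FreeMonoid (Fin l) => H) 2 :=
    lp.mapCLM 2 (fun _ => X) (norm_nonneg X) fun _ => le_rfl
  refine ⟨ContinuousLinearMapWOT.ofCLM (ContinuousLinearMap.adjoint K ∘L D ∘L K),
    hasSum_wot_of_quadratic fun x => ?_⟩
  change HasSum _ (inner ℂ x (ContinuousLinearMap.adjoint K (D (K x))))
  rw [ContinuousLinearMap.adjoint_inner_right]
  refine (lp.hasSum_inner (K x) (D (K x))).congr_fun fun α => ?_
  have hD : D (K x) α = X (K x α) := rfl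
  rw [inner_cpTerm, hD, hK]
  change _ = inner ℂ ((√(f.coeff α) : ℂ) • wordAdj A α x) (X ((√(f.coeff α) : ℂ) • wordAdj A α x))
  rw [map_smul, inner_smul_left, inner_smul_right, ← mul_assoc, Complex.conj_ofReal,
    ← Complex.ofReal_mul, Real.mul_self_sqrt (f.coeff_nonneg α)]

lemma quadForm_cpMap (hA : IsWeaklyConvergent f A) {X : H →L[ℂ] H} (hX : 0 ≤ X) :
    0 ≤ cpMap f A X ∧ quadForm (cpMap f A X) = cpForm f A (quadForm X) := by
  have hq : ∀ α, quadForm (ContinuousLinearMapWOT.toCLM (cpTerm f A X α)) =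
      FormOp.point (ENNReal.ofReal (f.coeff α)) (wordAdj A α) (quadForm X) := by
    intro α
    funext h
    have : (inner ℂ h (cpTerm f A X α h)).re =
        f.coeff α * (inner ℂ (wordAdj A α h) (X (wordAdj A α h))).re := by
      rw [inner_cpTerm, Complex.re_ofReal_mul]
    change ENNReal.ofReal (inner ℂ h (cpTerm f A X α h)).re = _
    rw [this, ENNReal.ofReal_mul (f.coeff_nonneg α)]
    rfl
  have hpos : ∀ α, 0 ≤ ContinuousLinearMapWOT.toCLM (cpTerm f A X α) := by
    intro α
    refine nonneg_iff_inner_eq.2 fun h => ?_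
    change inner ℂ h (cpTerm f A X α h) = _
    rw [hq, inner_cpTerm, nonneg_iff_inner_eq.1 hX, FormOp.point_apply, ENNReal.toReal_mul,
      ENNReal.toReal_ofReal (f.coeff_nonneg α)]
    push_cast
    rfl
  have := quadForm_hasSum hpos (T := cpMap f A X) (summable_cpTerm hA X).hasSum
  refine ⟨this.1, funext fun h => ?_⟩
  rw [this.2 h]
  exact tsum_congr fun α => congrFun (hq α) h

end CpMap

/-! ### Ordered products and compositions -/

lemma pow_update {M : Type*} [Monoid M] {k : ℕ} (x : Fin k → M) (s : Fin k → ℕ) (i : Fin k) :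
    (fun t => x t ^ Function.update s i (s i + 1) t) =
      Function.update (fun t => x t ^ s t) i (x i * x i ^ s i) := by
  funext t
  by_cases h : t = i
  · subst h; simp [pow_succ']
  · simp [h]

lemma iterComp_zero {X : Type*} {k : ℕ} (φ : Fin k → X → X) (x : X) : iterComp φ 0 x = x := by
  have h : ∀ L : List (X → X), (∀ g ∈ L, g = id) → L.foldr (· ∘ ·) id = id := by
    intro L hL
    induction L with
    | nil => rfl
    | cons g L ih => rw [List.foldr_cons, ih fun g hg => hL g (by simp [hg]), hL g (by simp)]; rfl
  rw [iterComp, h _ fun g hg => ?_]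
  · rfl
  · obtain ⟨i, rfl⟩ := List.mem_ofFn.1 hg
    rfl

lemma iterComp_update {X : Type*} {k : ℕ} (φ : Fin k → X → X) (s : Fin k → ℕ) (i : Fin k)
    (hs : ∀ j < i, s j = 0) (x : X) :
    iterComp φ (Function.update s i (s i + 1)) x = φ i (iterComp φ s x) := by
  let y : Fin k → Function.End X := fun t => (φ t)^[s t]
  let a : Function.End X := φ i
  have h1 : (fun t => (φ t)^[Function.update s i (s i + 1) t]) =
      Function.update y i (a * y i) := by
    funext t
    by_cases h : t = i
    · subst h
      rw [Function.update_self, Function.update_self, Function.iterate_succ']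
      rfl
    · rw [Function.update_of_ne h, Function.update_of_ne h]
  have h2 : ∀ z : Fin k → Function.End X,
      (List.ofFn z).foldr (fun g h : X → X => g ∘ h) id = (List.ofFn z).prod := fun _ => rfl
  have h3 := prod_ofFn_update y i a fun j hj => by
    have : y j = 1 := by simp only [y, hs j hj]; rfl
    rw [this]
    exact Commute.one_right _
  have h4 : iterComp φ (Function.update s i (s i + 1)) = φ i ∘ iterComp φ s := by
    unfold iterComp
    rw [h1]
    exact h3
  rw [h4]
  rfl

namespace FormOp

variable {H : Type*} {k : ℕ}

/-- The product `(1 - φ_1)^{-p_1} ⋯ (1 - φ_k)^{-p_k}` of powers of geometric series. -/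
def geomProd (φ : Fin k → FormOp H) (p : Fin k → ℕ) : FormOp H :=
  (List.ofFn fun i => geom (φ i) ^ p i).prod

variable {φ : Fin k → FormOp H}

lemma geomProd_zero : geomProd φ 0 = 1 := by
  simp [geomProd]

lemma geomProd_update (hφ : ∀ i, IsNormal (φ i)) (hc : ∀ i j, i ≠ j → Commute (φ i) (φ j))
    (p : Fin k → ℕ) (i : Fin k) :
    geomProd φ (Function.update p i (p i + 1)) = geom (φ i) * geomProd φ p := by
  rw [geomProd, pow_update (fun i => geom (φ i))]
  exact prod_ofFn_update (fun i => geom (φ i) ^ p i) i _ fun j hj =>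
    ((hφ i).commute_geom (hφ j) (hc i j hj.ne')).pow_right _

/-- Raising `p_i` may also be seen as applying the geometric series first. -/
lemma geomProd_update' (hφ : ∀ i, IsNormal (φ i)) (hc : ∀ i j, i ≠ j → Commute (φ i) (φ j))
    (p : Fin k → ℕ) (i : Fin k) :
    geomProd φ (Function.update p i (p i + 1)) = geomProd φ p * geom (φ i) := by
  rw [geomProd_update hφ hc]
  refine Commute.list_prod_right _ _ fun χ hχ => ?_
  obtain ⟨j, rfl⟩ := List.mem_ofFn.1 hχ
  refine Commute.pow_right ?_ _
  by_cases h : i = j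
  · subst h; exact Commute.refl _
  · exact (hφ i).commute_geom (hφ j) (hc i j h)

lemma geomProd_eq_sum (hφ : ∀ i, IsNormal (φ i)) {m : Fin k → ℕ} (hm : ∀ i, 1 ≤ m i) :
    geomProd φ m = sum fun s : Fin k → ℕ =>
      ((∏ i, (s i + m i - 1).choose (m i - 1) : ℕ) : ℝ≥0∞) •
        (List.ofFn fun i => φ i ^ s i).prod := by
  unfold geomProd
  simp only [fun i => (hφ i).geom_pow (hm i)]
  rw [prod_sum (X := fun _ => ℕ) (fun i (s : ℕ) =>
    ((s + m i - 1).choose (m i - 1) : ℝ≥0∞) • φ i ^ s) fun i s => ((hφ i).pow s).smul _]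
  congr 1
  funext s
  rw [prod_smul]
  push_cast
  rfl

end FormOp

/-! ### Positive solutions of the defect inequalities -/

section Defect

open FormOp

variable {H : Type*} [NormedAddCommGroup H] [InnerProductSpace ℂ H] [CompleteSpace H]
variable {k : ℕ} {n : Fin k → ℕ} {f : ∀ i, PosRegular (n i)} {A : ∀ i, Fin (n i) → H →L[ℂ] H}
variable {m : Fin k → ℕ}

/-- The operators induced by `Φ_{f_1,A_1}, …, Φ_{f_k,A_k}` on quadratic forms. -/
def cpForms (f : ∀ i, PosRegular (n i)) (A : ∀ i, Fin (n i) → H →L[ℂ] H) (i : Fin k) : FormOp H :=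
  cpForm (f i) (A i)

lemma isNormal_cpForms (i : Fin k) : IsNormal (cpForms f A i) := isNormal_cpForm _ _

lemma commute_cpForms (hcomm : IsCommutingTuple A) (i j : Fin k) (hij : i ≠ j) :
    Commute (cpForms f A i) (cpForms f A j) := by
  refine (isNormal_cpForm _ _).commute_sum fun β => Commute.symm ?_
  refine (isNormal_point _ _).commute_sum fun α => ?_
  have h : Commute (wordOp (A i) α) (wordOp (A j) β) :=
    commute_wordOp (fun t => (commute_wordOp (fun s => hcomm j i hij.symm t s) α).symm) β
  have h' : ∀ x, wordAdj (A j) β (wordAdj (A i) α x) = wordAdj (A i) α (wordAdj (A j) β x) := by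
    intro x
    have := congrArg star h.eq
    rw [star_mul, star_mul] at this
    exact congrArg (fun S : H →L[ℂ] H => S x) this
  refine LinearMap.ext fun q => funext fun x => ?_
  simp only [Module.End.mul_apply, point_apply, h']
  ring

lemma quadForm_cpTuple (hconv : ∀ i, IsWeaklyConvergent (f i) (A i)) {X : H →L[ℂ] H}
    (hX : 0 ≤ X) (i : Fin k) :
    0 ≤ cpTuple f A i X ∧ quadForm (cpTuple f A i X) = cpForms f A i (quadForm X) :=
  quadForm_cpMap (hconv i) hX

lemma quadForm_iterComp (hconv : ∀ i, IsWeaklyConvergent (f i) (A i)) {R : H →L[ℂ] H}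
    (hR : 0 ≤ R) (s : Fin k → ℕ) :
    0 ≤ iterComp (cpTuple f A) s R ∧ quadForm (iterComp (cpTuple f A) s R) =
      (List.ofFn fun i => cpForms f A i ^ s i).prod (quadForm R) := by
  induction s using multiIndex_induction with
  | h0 =>
    rw [iterComp_zero]
    exact ⟨hR, by simp⟩
  | hs s i hs ih =>
    rw [iterComp_update _ _ _ hs, pow_update, prod_ofFn_update (fun t => cpForms f A t ^ s t) i _
      fun j hj => by rw [hs j hj]; simp]
    rw [Module.End.mul_apply, ← ih.2]
    exact quadForm_cpTuple hconv ih.1 i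

/-- The series `∑_s C(s_1+m_1-1, m_1-1) ⋯ Φ^s(R)` converges to `T` if and only if the form of `T` is
obtained from that of `R` by the operator `(1 - φ_1)^{-m_1} ⋯ (1 - φ_k)^{-m_k}`. -/
lemma hasSum_series_iff (hm : ∀ i, 1 ≤ m i) (hconv : ∀ i, IsWeaklyConvergent (f i) (A i))
    {R T : H →L[ℂ] H} (hR : 0 ≤ R) :
    HasSum (fun s : Fin k → ℕ => ContinuousLinearMapWOT.ofCLM
      (((∏ i, (s i + m i - 1).choose (m i - 1) : ℕ) : ℂ) • iterComp (cpTuple f A) s R))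
      (ContinuousLinearMapWOT.ofCLM T) ↔
    0 ≤ T ∧ quadForm T = geomProd (cpForms f A) m (quadForm R) := by
  have hcast : ∀ N : ℕ, (N : ℂ) = ((N : ℝ) : ℂ) := fun N => by push_cast; rfl
  have hpos : ∀ s : Fin k → ℕ, 0 ≤ ((∏ i, (s i + m i - 1).choose (m i - 1) : ℕ) : ℂ) •
      iterComp (cpTuple f A) s R := by
    intro s
    rw [hcast]
    exact smul_nonneg_ofReal (quadForm_iterComp hconv hR s).1 (Nat.cast_nonneg _)
  have hq : ∀ x, ∑' s : Fin k → ℕ, quadForm (((∏ i, (s i + m i - 1).choose (m i - 1) : ℕ) : ℂ) •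
      iterComp (cpTuple f A) s R) x = geomProd (cpForms f A) m (quadForm R) x := by
    intro x
    rw [geomProd_eq_sum isNormal_cpForms hm, sum_apply]
    refine tsum_congr fun s => ?_
    rw [hcast, quadForm_smul (Nat.cast_nonneg _), (quadForm_iterComp hconv hR s).2,
      ENNReal.ofReal_natCast]
    rfl
  constructor
  · intro h
    have := quadForm_hasSum hpos h
    exact ⟨this.1, funext fun x => (this.2 x).trans (hq x)⟩
  · rintro ⟨h1, h2⟩
    exact hasSum_wot_of_quadForm hpos h1 fun x => (congrFun h2 x).trans (hq x).symm

/-- If `T = (1 - Φ)^{-m}(r)` in terms of forms, then `(1 - Φ)^p(T)` is positive with form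
`(1 - Φ)^{-(m-p)}(r)` for all `p ≤ m`. -/
lemma defect_of_geomProd (hcomm : IsCommutingTuple A)
    (hconv : ∀ i, IsWeaklyConvergent (f i) (A i)) {T : H →L[ℂ] H} (hT : 0 ≤ T) {r : H → ℝ≥0∞}
    (h : quadForm T = geomProd (cpForms f A) m r) (p : Fin k → ℕ) (hp : p ≤ m) :
    0 ≤ defect (cpTuple f A) p T ∧
      quadForm (defect (cpTuple f A) p T) = geomProd (cpForms f A) (m - p) r := by
  induction p using multiIndex_induction with
  | h0 =>
    have : defect (cpTuple f A) 0 T = T := iterComp_zero _ _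
    rw [this, tsub_zero]
    exact ⟨hT, h⟩
  | hs p i hs ih =>
    have hpi : p i + 1 ≤ m i := by simpa using hp i
    have hp' : p ≤ m := fun t => by
      refine le_trans ?_ (hp t)
      by_cases ht : t = i
      · subst ht; simp
      · simp [ht]
    obtain ⟨h1, h2⟩ := ih hp'
    have e : m - p = Function.update (m - Function.update p i (p i + 1)) i
        ((m - Function.update p i (p i + 1)) i + 1) := by
      funext t
      by_cases ht : t = i
      · subst ht
        simp only [Pi.sub_apply, Function.update_self]
        omega
      · simp [ht]
    have hstep : defect (cpTuple f A) (Function.update p i (p i + 1)) T =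
        defect (cpTuple f A) p T - cpTuple f A i (defect (cpTuple f A) p T) :=
      iterComp_update _ _ _ hs _
    have h3 := quadForm_cpTuple hconv h1 i
    rw [hstep]
    refine sub_nonneg_of_quadForm h1 h3.1 ?_
    rw [h3.2, h2, e, geomProd_update isNormal_cpForms (commute_cpForms hcomm)]
    rw [Module.End.mul_apply]
    conv_lhs => rw [(isNormal_cpForms (f := f) (A := A) i).geom_eq]
    rfl

lemma quadForm_cpTuple_iterate (hconv : ∀ i, IsWeaklyConvergent (f i) (A i)) {X : H →L[ℂ] H}
    (hX : 0 ≤ X) (i : Fin k) (N : ℕ) :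
    0 ≤ (cpTuple f A i)^[N] X ∧
      quadForm ((cpTuple f A i)^[N] X) = (cpForms f A i ^ N) (quadForm X) := by
  induction N with
  | zero => exact ⟨hX, rfl⟩
  | succ N ih =>
    rw [Function.iterate_succ_apply', pow_succ', Module.End.mul_apply, ← ih.2]
    exact quadForm_cpTuple hconv ih.1 i

lemma tendsto_iterate_iff (hconv : ∀ i, IsWeaklyConvergent (f i) (A i)) {X : H →L[ℂ] H}
    (hX : 0 ≤ X) (i : Fin k) :
    Tendsto (fun s : ℕ => ContinuousLinearMapWOT.ofCLM ((cpTuple f A i)^[s] X)) atTop (𝓝 0) ↔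
      ∀ x, Tendsto (fun s : ℕ => (cpForms f A i ^ s) (quadForm X) x) atTop (𝓝 0) := by
  have key : ∀ s x, inner ℂ x ((cpTuple f A i)^[s] X x) =
      (((cpForms f A i ^ s) (quadForm X) x).toReal : ℂ) := by
    intro s x
    obtain ⟨h1, h2⟩ := quadForm_cpTuple_iterate hconv hX i s
    rw [nonneg_iff_inner_eq.1 h1 x, h2]
  have hfin : ∀ s x, (cpForms f A i ^ s) (quadForm X) x ≠ ⊤ := by
    intro s x
    rw [← (quadForm_cpTuple_iterate hconv hX i s).2]
    exact quadForm_ne_top _ _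
  constructor
  · intro h x
    have h1 := ContinuousLinearMapWOT.tendsto_iff_forall_inner_apply_tendsto.1 h x x
    have h2 := (Complex.continuous_re.tendsto _).comp h1
    have h3 : Tendsto (fun s => ((cpForms f A i ^ s) (quadForm X) x).toReal) atTop (𝓝 0) := by
      have h0 : (inner ℂ x ((0 : H →WOT[ℂ] H) x)).re = 0 := by simp
      rw [h0] at h2
      refine h2.congr fun s => ?_
      exact (congrArg Complex.re (key s x)).trans (Complex.ofReal_re _)
    exact (ENNReal.tendsto_toReal_iff (fun s => hfin s x) ENNReal.zero_ne_top).1 (by simpa using h3)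
  · intro h
    refine tendsto_wot_of_quadratic fun x => ?_
    have h3 := (ENNReal.tendsto_toReal ENNReal.zero_ne_top).comp (h x)
    have h4 := (Complex.continuous_ofReal.tendsto _).comp h3
    have h0 : inner ℂ x ((0 : H →WOT[ℂ] H) x) = (((0 : ℝ≥0∞).toReal : ℝ) : ℂ) := by simp
    rw [h0]
    exact h4.congr fun s => (key s x).symm

/-- The tails of a convergent geometric series tend to zero. -/
lemma tendsto_pow_geom {X : Type*} {φ : FormOp X} (hφ : φ.IsNormal) {u : X → ℝ≥0∞} (x : X)
    (hfin : geom φ u x ≠ ⊤) : Tendsto (fun N : ℕ => (φ ^ N) (geom φ u) x) atTop (𝓝 0) := by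
  have h : ∀ N : ℕ, (φ ^ N) (geom φ u) x = ∑' s, (φ ^ (s + N)) u x := by
    intro N
    rw [← Module.End.mul_apply, geom, (hφ.pow N).mul_sum, sum_apply]
    simp only [← pow_add, add_comm]
  simp only [h]
  exact ENNReal.tendsto_sum_nat_add (fun s => (φ ^ s) u x) hfin

/-- A fixed point equation `q = r + φ q` whose iterated remainders tend to zero is solved by the
geometric series. -/
lemma eq_geom_of_tendsto {X : Type*} {φ : FormOp X} {q r : X → ℝ≥0∞} (h : q = r + φ q)
    (hlim : ∀ x, Tendsto (fun N : ℕ => (φ ^ N) q x) atTop (𝓝 0)) : q = geom φ r := by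
  have hN : ∀ N : ℕ, q = ∑ s ∈ Finset.range N, (φ ^ s) r + (φ ^ N) q := by
    intro N
    induction N with
    | zero => simp
    | succ N ih =>
      rw [Finset.sum_range_succ, pow_succ, Module.End.mul_apply, add_assoc, ← map_add, ← h]
      exact ih
  funext x
  have h1 : Tendsto (fun N : ℕ => ∑ s ∈ Finset.range N, (φ ^ s) r x + (φ ^ N) q x) atTop
      (𝓝 (geom φ r x + 0)) := (ENNReal.tendsto_nat_tsum _).add (hlim x)
  rw [add_zero] at h1
  refine tendsto_nhds_unique (tendsto_const_nhds.congr fun N => ?_) h1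
  conv_lhs => rw [hN N]
  simp

/-- A pure solution `Q` of the defect inequalities is recovered from its defect `(1 - Φ)^m(Q)` by
inverting one factor `1 - Φ_i` at a time. -/
lemma geomProd_defect (hcomm : IsCommutingTuple A)
    (hconv : ∀ i, IsWeaklyConvergent (f i) (A i)) {Q : H →L[ℂ] H}
    (hQ : Q ∈ posCone (cpTuple f A) m)
    (hpure : ∀ i, Tendsto (fun s : ℕ => ContinuousLinearMapWOT.ofCLM ((cpTuple f A i)^[s] Q))
      atTop (𝓝 0)) (p : Fin k → ℕ) (hp : p ≤ m) :
    geomProd (cpForms f A) p (quadForm (defect (cpTuple f A) p Q)) = quadForm Q ∧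
      quadForm (defect (cpTuple f A) p Q) ≤ quadForm Q := by
  induction p using multiIndex_induction with
  | h0 =>
    have : defect (cpTuple f A) 0 Q = Q := iterComp_zero _ _
    rw [this, geomProd_zero]
    exact ⟨rfl, le_rfl⟩
  | hs p i hs ih =>
    have hp' : p ≤ m := fun t => by
      refine le_trans ?_ (hp t)
      by_cases ht : t = i
      · subst ht; simp
      · simp [ht]
    obtain ⟨h1, h2⟩ := ih hp'
    have hX := hQ.2 p hp'
    have hX' := hQ.2 _ hp
    have hstep : defect (cpTuple f A) (Function.update p i (p i + 1)) Q =
        defect (cpTuple f A) p Q - cpTuple f A i (defect (cpTuple f A) p Q) :=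
      iterComp_update _ _ _ hs _
    set X := defect (cpTuple f A) p Q with hXdef
    set X' := defect (cpTuple f A) (Function.update p i (p i + 1)) Q with hX'def
    have h3 := quadForm_cpTuple hconv hX i
    have h4 : quadForm X = quadForm X' + cpForms f A i (quadForm X) := by
      have : X = X' + cpTuple f A i X := by rw [hstep]; abel
      conv_lhs => rw [this, quadForm_add hX' h3.1]
      exact congrArg _ h3.2
    have h5 : quadForm X = geom (cpForms f A i) (quadForm X') := by
      refine eq_geom_of_tendsto h4 fun x => ?_
      refine tendsto_of_tendsto_of_tendsto_of_le_of_le tendsto_const_nhds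
        ((tendsto_iterate_iff hconv hQ.1 i).1 (hpure i) x) (fun _ => zero_le) fun N => ?_
      exact monotone _ h2 x
    refine ⟨?_, le_trans ?_ h2⟩
    · rw [geomProd_update' isNormal_cpForms (commute_cpForms hcomm), Module.End.mul_apply, ← h5, h1]
    · rw [h4]
      exact le_self_add

end Defect

/-! ### Bounds for positive operators -/

section Equivalence

open FormOp

variable {H : Type*} [NormedAddCommGroup H] [InnerProductSpace ℂ H]

lemma le_of_quadForm_le {X Y : H →L[ℂ] H} (hX : 0 ≤ X) (hY : 0 ≤ Y)
    (h : quadForm X ≤ quadForm Y) : X ≤ Y := by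
  have := (sub_nonneg_of_quadForm hY hX (g := quadForm Y - quadForm X)
    (tsub_add_cancel_of_le h).symm).1
  exact (ContinuousLinearMap.nonneg_iff_isPositive _).1 this

lemma quadForm_smul_one {c : ℝ} (hc : 0 ≤ c) (h : H) :
    quadForm ((c : ℂ) • (1 : H →L[ℂ] H)) h = ENNReal.ofReal (c * ‖h‖ ^ 2) := by
  rw [quadForm_smul hc, Pi.smul_apply, quadForm_one, smul_eq_mul, ENNReal.ofReal_mul hc]

lemma nonneg_smul_one {c : ℝ} (hc : 0 ≤ c) : 0 ≤ (c : ℂ) • (1 : H →L[ℂ] H) :=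
  smul_nonneg_ofReal (X := 1)
    ((ContinuousLinearMap.nonneg_iff_isPositive _).2 ContinuousLinearMap.isPositive_one) hc

lemma smul_one_le_iff {c : ℝ} (hc : 0 ≤ c) {T : H →L[ℂ] H} (hT : 0 ≤ T) :
    (c : ℂ) • (1 : H →L[ℂ] H) ≤ T ↔ ∀ h, ENNReal.ofReal (c * ‖h‖ ^ 2) ≤ quadForm T h := by
  refine ⟨fun h x => ?_, fun h => le_of_quadForm_le (nonneg_smul_one hc) hT fun x => ?_⟩
  · rw [← quadForm_smul_one hc]
    exact quadForm_mono h x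
  · rw [quadForm_smul_one hc]
    exact h x

lemma le_smul_one_iff {c : ℝ} (hc : 0 ≤ c) {T : H →L[ℂ] H} (hT : 0 ≤ T) :
    T ≤ (c : ℂ) • (1 : H →L[ℂ] H) ↔ ∀ h, quadForm T h ≤ ENNReal.ofReal (c * ‖h‖ ^ 2) := by
  refine ⟨fun h x => ?_, fun h => le_of_quadForm_le hT (nonneg_smul_one hc) fun x => ?_⟩
  · rw [← quadForm_smul_one hc]
    exact quadForm_mono h x
  · rw [quadForm_smul_one hc]
    exact h x

lemma norm_bounds_of_quadForm {E : Type*} [NormedAddCommGroup E] [NormedSpace ℂ E] {K : H →L[ℂ] E}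
    {T : H →L[ℂ] H} {a b : ℝ} (ha : 0 ≤ a) (hb : 0 ≤ b) (hT : 0 ≤ T)
    (haT : (a : ℂ) • (1 : H →L[ℂ] H) ≤ T) (hTb : T ≤ (b : ℂ) • (1 : H →L[ℂ] H))
    (hK : ∀ x, ENNReal.ofReal (‖K x‖ ^ 2) = quadForm T x) :
    (∀ x, √a * ‖x‖ ≤ ‖K x‖) ∧ ∀ x, ‖K x‖ ≤ √b * ‖x‖ := by
  refine ⟨fun x => ?_, fun x => ?_⟩
  · have h1 := (smul_one_le_iff ha hT).1 haT x
    rw [← hK, ENNReal.ofReal_le_ofReal_iff (by positivity)] at h1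
    refine abs_le_of_sq_le_sq' ?_ (by positivity) |>.2
    rwa [mul_pow, Real.sq_sqrt ha]
  · have h1 := (le_smul_one_iff hb hT).1 hTb x
    rw [← hK, ENNReal.ofReal_le_ofReal_iff (by positivity)] at h1
    refine abs_le_of_sq_le_sq' ?_ (by positivity) |>.2
    rwa [mul_pow, Real.sq_sqrt hb]

variable [CompleteSpace H]

/-- Every positive operator is of the form `S^* S`, with `S` invertible if the operator is. -/
lemma exists_adjoint_mul_self {X : H →L[ℂ] H} (hX : 0 ≤ X) :
    ∃ S : H →L[ℂ] H, ContinuousLinearMap.adjoint S * S = X ∧ (IsUnit X → IsUnit S) := by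
  refine ⟨CFC.sqrt X, ?_, fun h => (CFC.isUnit_sqrt_iff X hX).2 h⟩
  rw [← ContinuousLinearMap.star_eq_adjoint,
    (IsSelfAdjoint.of_nonneg (CFC.sqrt_nonneg X)).star_eq, CFC.sqrt_mul_sqrt_self X hX]

/-- A positive invertible operator lies between two positive multiples of the identity. -/
lemma exists_bounds_of_isUnit {X : H →L[ℂ] H} (hX : 0 ≤ X) (hu : IsUnit X) :
    ∃ a b : ℝ, 0 < a ∧ a ≤ b ∧ (a : ℂ) • (1 : H →L[ℂ] H) ≤ X ∧
      X ≤ (b : ℂ) • (1 : H →L[ℂ] H) := by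
  obtain ⟨S, rfl, hS⟩ := exists_adjoint_mul_self hX
  obtain ⟨U, hU⟩ := (hS hu)
  set V : H →L[ℂ] H := ↑U⁻¹
  set c := ‖V‖ + 1
  have hc : 0 < c := by positivity
  have hinv : ∀ x, ‖x‖ ≤ c * ‖S x‖ := by
    intro x
    have : x = V (S x) := by
      rw [← mul_apply_eq_comp, ← hU, U.inv_mul]
      rfl
    calc ‖x‖ = ‖V (S x)‖ := by rw [← this]
      _ ≤ ‖V‖ * ‖S x‖ := V.le_opNorm _
      _ ≤ c * ‖S x‖ := by gcongr; simp [c]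
  refine ⟨(c ^ 2)⁻¹, (c ^ 2)⁻¹ + ‖S‖ ^ 2, by positivity, by nlinarith [norm_nonneg S], ?_, ?_⟩
  · refine (smul_one_le_iff (by positivity) hX).2 fun x => ?_
    rw [quadForm_adjoint_mul]
    refine ENNReal.ofReal_le_ofReal ?_
    rw [inv_mul_le_iff₀ (by positivity), ← mul_pow]
    exact pow_le_pow_left₀ (norm_nonneg _) (hinv x) 2
  · refine (le_smul_one_iff (by positivity) hX).2 fun x => ?_
    rw [quadForm_adjoint_mul]
    refine ENNReal.ofReal_le_ofReal ?_
    calc ‖S x‖ ^ 2 ≤ (‖S‖ * ‖x‖) ^ 2 := by gcongr; exact S.le_opNorm x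
      _ = ‖S‖ ^ 2 * ‖x‖ ^ 2 := by ring
      _ ≤ _ := by gcongr; simp; positivity

lemma isUnit_of_smul_one_le {a : ℝ} (ha : 0 < a) {T : H →L[ℂ] H}
    (h : (a : ℂ) • (1 : H →L[ℂ] H) ≤ T) (hT : 0 ≤ T) : IsUnit T := by
  refine ContinuousLinearMap.isUnit_of_forall_le_norm_inner_map T (c := ⟨a, ha.le⟩) ha fun x => ?_
  have h1 := (smul_one_le_iff ha.le hT).1 h x
  rw [← ENNReal.toReal_le_toReal ENNReal.ofReal_ne_top (quadForm_ne_top _ _),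
    ENNReal.toReal_ofReal (by positivity), ← re_inner_eq_toReal_quadForm hT] at h1
  rw [norm_inner_symm]
  calc ‖x‖ ^ 2 * a = a * ‖x‖ ^ 2 := mul_comm _ _
    _ ≤ (inner ℂ x (T x)).re := h1
    _ ≤ _ := Complex.re_le_norm _

/-! ### Pure solutions of the defect inequalities and convergent series -/

variable {k : ℕ} {n : Fin k → ℕ} {f : ∀ i, PosRegular (n i)} {A : ∀ i, Fin (n i) → H →L[ℂ] H}
variable {m : Fin k → ℕ}

/-- Since `m_i ≥ 1`, a factor `G_i` can be split off. -/
lemma geomProd_eq_geom (hcomm : IsCommutingTuple A) (hm : ∀ i, 1 ≤ m i) (i : Fin k)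
    (r : H → ℝ≥0∞) : ∃ u, geomProd (cpForms f A) m r = geom (cpForms f A i) u := by
  have e : m = Function.update (Function.update m i (m i - 1)) i
      (Function.update m i (m i - 1) i + 1) := by
    funext t
    by_cases ht : t = i
    · subst ht
      have := hm t
      simp only [Function.update_self]
      omega
    · simp [ht]
  rw [e, geomProd_update isNormal_cpForms (commute_cpForms hcomm)]
  exact ⟨_, rfl⟩

/-- The sum of the series is a pure invertible solution of the defect inequalities. -/
lemma exists_pure_of_seriesBetween (hm : ∀ i, 1 ≤ m i) (hcomm : IsCommutingTuple A)
    (hconv : ∀ i, IsWeaklyConvergent (f i) (A i)) {a b : ℝ} (ha : 0 < a) {R : H →L[ℂ] H}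
    (hR : 0 ≤ R) (h : SeriesBetween (cpTuple f A) m R a b) :
    ∃ Q ∈ posCone (cpTuple f A) m, IsUnit Q ∧
      ∀ i, Tendsto (fun s : ℕ => ContinuousLinearMapWOT.ofCLM ((cpTuple f A i)^[s] Q))
        atTop (𝓝 0) := by
  obtain ⟨T, hT, haT, -⟩ := h
  obtain ⟨hT0, hTq⟩ := (hasSum_series_iff hm hconv hR).1 hT
  refine ⟨T, ⟨hT0, fun p hp => (defect_of_geomProd hcomm hconv hT0 hTq p hp).1⟩,
    isUnit_of_smul_one_le ha haT hT0, fun i => ?_⟩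
  rw [tendsto_iterate_iff hconv hT0]
  intro x
  obtain ⟨u, hu⟩ := geomProd_eq_geom hcomm hm i (f := f) (quadForm R)
  rw [hTq, hu]
  refine tendsto_pow_geom (isNormal_cpForms i) x ?_
  rw [← hu, ← hTq]
  exact quadForm_ne_top _ _

/-- The defect of a pure invertible solution generates a series whose sum is that solution. -/
lemma exists_seriesBetween_of_pure (hm : ∀ i, 1 ≤ m i) (hcomm : IsCommutingTuple A)
    (hconv : ∀ i, IsWeaklyConvergent (f i) (A i)) {Q : H →L[ℂ] H}
    (hQ : Q ∈ posCone (cpTuple f A) m) (hu : IsUnit Q)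
    (hpure : ∀ i, Tendsto (fun s : ℕ => ContinuousLinearMapWOT.ofCLM ((cpTuple f A i)^[s] Q))
      atTop (𝓝 0)) :
    ∃ a b : ℝ, 0 < a ∧ a ≤ b ∧ ∃ R : H →L[ℂ] H, 0 ≤ R ∧
      SeriesBetween (cpTuple f A) m R a b := by
  obtain ⟨a, b, ha, hab, h1, h2⟩ := exists_bounds_of_isUnit hQ.1 hu
  have hR := hQ.2 m le_rfl
  exact ⟨a, b, ha, hab, _, hR, Q, (hasSum_series_iff hm hconv hR).2
    ⟨hQ.1, (geomProd_defect hcomm hconv hQ hpure m le_rfl).1.symm⟩, h1, h2⟩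

/-! ### Summation over tuples of words -/

lemma prod_point_adjoint : ∀ {k : ℕ} (w : Fin k → ℝ≥0∞) (T : Fin k → H →L[ℂ] H),
    (List.ofFn fun i => point (w i) (ContinuousLinearMap.adjoint (T i) : H → H)).prod =
      point (∏ i, w i) (ContinuousLinearMap.adjoint (List.ofFn T).prod : H → H)
  | 0, w, T => by
    refine LinearMap.ext fun q => funext fun x => ?_
    have : ContinuousLinearMap.adjoint (1 : H →L[ℂ] H) = 1 := by
      rw [← ContinuousLinearMap.star_eq_adjoint, star_one]
    simp [point_apply, this]
  | k + 1, w, T => by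
    rw [List.ofFn_succ, List.prod_cons, prod_point_adjoint (fun i => w i.succ) fun i => T i.succ,
      List.ofFn_succ, List.prod_cons, Fin.prod_univ_succ]
    refine LinearMap.ext fun q => funext fun x => ?_
    have : ContinuousLinearMap.adjoint (T 0 * (List.ofFn fun i => T i.succ).prod) =
        ContinuousLinearMap.adjoint (List.ofFn fun i => T i.succ).prod *
          ContinuousLinearMap.adjoint (T 0) := by
      simp only [← ContinuousLinearMap.star_eq_adjoint, star_mul]
    rw [this, Module.End.mul_apply, point_apply, point_apply, point_apply, mul_assoc]
    rfl

/-- The product of the coefficients `b_{i,β_i}` over a tuple of words. -/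
def multiB (f : ∀ i, PosRegular (n i)) (m : Fin k → ℕ) (β : ∀ i, FreeMonoid (Fin (n i))) : ℝ :=
  ∏ i, (f i).b (m i) (β i)

lemma multiB_pos (f : ∀ i, PosRegular (n i)) (m : Fin k → ℕ) (β : ∀ i, FreeMonoid (Fin (n i))) :
    0 < multiB f m β := Finset.prod_pos fun i _ => (f i).b_pos _ _

/-- `(1 - φ)^{-m}` applied to the form of `S^* S` is the sum of the terms
`b_β ‖S A_β^* x‖²` over all tuples of words. -/
lemma geomProd_quadForm (hm : ∀ i, 1 ≤ m i) (S : H →L[ℂ] H) (x : H) :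
    geomProd (cpForms f A) m (quadForm (ContinuousLinearMap.adjoint S * S)) x =
      ∑' β : ∀ i, FreeMonoid (Fin (n i)), ENNReal.ofReal (multiB f m β *
        ‖S (ContinuousLinearMap.adjoint (multiWordOp A β) x)‖ ^ 2) := by
  have hk : ∀ i, geom (cpForms f A i) ^ m i = kernel ((f i).b (m i)) (wordAdj (A i)) := fun i =>
    (kernel_b (f i) (hm i) (wordAdj_one (A i)) (wordAdj_mul (A i))).symm
  have h : geomProd (cpForms f A) m = sum fun β : ∀ i, FreeMonoid (Fin (n i)) =>
      point (∏ i, ENNReal.ofReal ((f i).b (m i) (β i)))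
        (ContinuousLinearMap.adjoint (multiWordOp A β) : H → H) := by
    unfold geomProd
    simp only [hk, kernel]
    rw [prod_sum (fun i (α : FreeMonoid (Fin (n i))) =>
      point (ENNReal.ofReal ((f i).b (m i) α)) (wordAdj (A i) α)) fun _ _ => isNormal_point _ _]
    congr 1
    funext β
    exact prod_point_adjoint _ fun i => wordOp (A i) (β i)
  rw [h, sum_apply]
  refine tsum_congr fun β => ?_
  rw [point_apply, quadForm_adjoint_mul, ENNReal.ofReal_mul (multiB_pos f m β).le, multiB,
    ENNReal.ofReal_prod_of_nonneg fun i _ => (f i).b_nonneg _ _]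

end Equivalence

/-! ### Operators on Hilbert space tensor products -/

namespace HilbertTensor

variable {K K' K'' H E : Type*} [NormedAddCommGroup K] [InnerProductSpace ℂ K]
  [NormedAddCommGroup K'] [InnerProductSpace ℂ K'] [NormedAddCommGroup K'']
  [InnerProductSpace ℂ K''] [NormedAddCommGroup H] [InnerProductSpace ℂ H]
  [NormedAddCommGroup E] [NormedSpace ℂ E]

/-- The elementary tensor `x ⊗ h`, as a bounded bilinear map. -/
def tmul : K →L[ℂ] H →L[ℂ] HilbertTensor K H :=
  (ContinuousLinearMap.compL ℂ H (K ⊗[ℂ] H) (HilbertTensor K H)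
    (incl K H).toContinuousLinearMap) ∘L TensorProduct.mkL ℂ K H

lemma tmul_eq (x : K) (h : H) : tmul x h = incl K H (x ⊗ₜ h) := rfl

lemma inner_tmul_tmul (x y : K) (g h : H) :
    inner ℂ (tmul x g) (tmul y h) = inner ℂ x y * inner ℂ g h := by
  rw [tmul_eq, tmul_eq, LinearIsometry.inner_map_map, TensorProduct.inner_tmul]

lemma clm_ext {S T : HilbertTensor K H →L[ℂ] E} (h : ∀ x g, S (tmul x g) = T (tmul x g)) :
    S = T := by
  refine ContinuousLinearMap.coeFn_injective
    ((denseRange_incl K H).equalizer S.continuous T.continuous (funext fun u => ?_))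
  change S (incl K H u) = T (incl K H u)
  induction u using TensorProduct.induction_on with
  | zero => simp
  | tmul x g => exact h x g
  | add u v hu hv => rw [map_add, map_add, map_add, hu, hv]

variable (H) in
/-- The operator `T ⊗ I_H` for an operator `T` between two Hilbert spaces. -/
def map (T : K →L[ℂ] K') : HilbertTensor K H →L[ℂ] HilbertTensor K' H :=
  ((incl K' H).toContinuousLinearMap ∘L T.rTensor H).extend (incl K H).toContinuousLinearMap

lemma map_tmul (T : K →L[ℂ] K') (x : K) (g : H) : map H T (tmul x g) = tmul (T x) g :=
  ContinuousLinearMap.extend_eq _ (denseRange_incl K H)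
    (incl K H).isometry.isUniformInducing _

lemma map_map (S : K' →L[ℂ] K'') (T : K →L[ℂ] K') (u : HilbertTensor K H) :
    map H S (map H T u) = map H (S ∘L T) u := by
  have : map H S ∘L map H T = map H (S ∘L T) := clm_ext fun x g => by
    rw [ContinuousLinearMap.comp_apply, map_tmul, map_tmul, map_tmul,
      ContinuousLinearMap.comp_apply]
  exact congrArg (fun R : HilbertTensor K H →L[ℂ] HilbertTensor K'' H => R u) this

lemma map_id (u : HilbertTensor K H) : map H (ContinuousLinearMap.id ℂ K) u = u := by
  have : map H (ContinuousLinearMap.id ℂ K) = ContinuousLinearMap.id ℂ _ :=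
    clm_ext fun x g => by rw [map_tmul]; rfl
  rw [this]
  rfl

lemma eq_of_inner_tmul {u v : HilbertTensor K H}
    (h : ∀ x g, inner ℂ u (tmul x g) = inner ℂ v (tmul x g)) : u = v := by
  have : innerSL ℂ u = innerSL ℂ v := clm_ext fun x g => h x g
  refine ext_inner_right ℂ fun w => ?_
  exact congrArg (fun R : HilbertTensor K H →L[ℂ] ℂ => R w) this

lemma adjoint_map [CompleteSpace K] [CompleteSpace K'] (T : K →L[ℂ] K') :
    ContinuousLinearMap.adjoint (map H T) = map H (ContinuousLinearMap.adjoint T) := by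
  refine clm_ext fun y g => eq_of_inner_tmul fun x h => ?_
  rw [ContinuousLinearMap.adjoint_inner_left, map_tmul, map_tmul, inner_tmul_tmul,
    inner_tmul_tmul, ContinuousLinearMap.adjoint_inner_left]

lemma norm_map_subtypeL [CompleteSpace K] (N : Submodule ℂ K) [CompleteSpace N]
    (u : HilbertTensor N H) : ‖map H N.subtypeL u‖ = ‖u‖ := by
  have h : ContinuousLinearMap.adjoint N.subtypeL ∘L N.subtypeL = ContinuousLinearMap.id ℂ N := by
    rw [Submodule.adjoint_subtypeL]
    ext x
    simp
  have h2 : inner ℂ (map H N.subtypeL u) (map H N.subtypeL u) = inner ℂ u u := by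
    rw [← ContinuousLinearMap.adjoint_inner_right, adjoint_map, map_map, h, map_id]
  rw [norm_eq_sqrt_re_inner (𝕜 := ℂ), h2, ← norm_eq_sqrt_re_inner]

end HilbertTensor

/-! ### Coordinates of vectors in `ℓ²(B) ⊗ H` -/

section Coordinates

variable {B H E : Type*} [DecidableEq B] [NormedAddCommGroup H] [InnerProductSpace ℂ H]
  [NormedAddCommGroup E] [NormedSpace ℂ E]

lemma lp_clm_ext {S T : lp (fun _ : B => ℂ) 2 →L[ℂ] E}
    (h : ∀ β, S (lp.single 2 β (1 : ℂ)) = T (lp.single 2 β (1 : ℂ))) : S = T := by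
  ext x
  have hx := lp.hasSum_single (E := fun _ : B => ℂ) (p := 2) (by simp) x
  have hc : ∀ β, lp.single (E := fun _ : B => ℂ) 2 β (x β) =
      x β • lp.single (E := fun _ : B => ℂ) 2 β (1 : ℂ) := by
    intro β
    rw [← lp.single_smul, smul_eq_mul, mul_one]
  refine (hx.mapL S).unique ?_
  convert hx.mapL T using 2 with β
  rw [hc, map_smul, map_smul, h]

namespace HilbertTensor

lemma clm_ext_single {S T : HilbertTensor (lp (fun _ : B => ℂ) 2) H →L[ℂ] E}
    (h : ∀ β g, S (tmul (lp.single 2 β (1 : ℂ)) g) = T (tmul (lp.single 2 β (1 : ℂ)) g)) :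
    S = T := by
  refine clm_ext fun x g => ?_
  have : S ∘L tmul.flip g = T ∘L tmul.flip g := lp_clm_ext fun β => h β g
  exact congrArg (fun R : lp (fun _ : B => ℂ) 2 →L[ℂ] E => R x) this

/-- The isometric embedding `h ↦ e_β ⊗ h`. -/
def singleTmul (H : Type*) [NormedAddCommGroup H] [InnerProductSpace ℂ H] (β : B) :
    H →ₗᵢ[ℂ] HilbertTensor (lp (fun _ : B => ℂ) 2) H where
  toLinearMap := (tmul (lp.single 2 β (1 : ℂ))).toLinearMap
  norm_map' h := by
    change ‖tmul (lp.single (E := fun _ : B => ℂ) 2 β (1 : ℂ)) h‖ = ‖h‖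
    rw [tmul_eq, LinearIsometry.norm_map, TensorProduct.norm_tmul, lp.norm_single (by simp)]
    simp

/-- `ℓ²(B) ⊗ H` is the Hilbert sum of the subspaces `e_β ⊗ H`. -/
lemma isHilbertSum_singleTmul [CompleteSpace H] :
    IsHilbertSum ℂ (fun _ : B => H) (singleTmul (B := B) H) := by
  refine IsHilbertSum.mk ?_ ?_
  · intro β γ hβγ g h
    change inner ℂ (tmul (lp.single (E := fun _ : B => ℂ) 2 β (1 : ℂ)) g)
      (tmul (lp.single (E := fun _ : B => ℂ) 2 γ (1 : ℂ)) h) = 0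
    rw [inner_tmul_tmul, lp.inner_single_left, lp.single_apply_ne _ _ _ hβγ]
    simp
  · rw [top_le_iff, Submodule.topologicalClosure_eq_top_iff, Submodule.eq_bot_iff]
    intro v hv
    have : innerSL ℂ v = 0 := clm_ext_single fun β g => by
      have h1 : singleTmul H β g ∈ ⨆ γ : B, LinearMap.range (singleTmul (B := B) H γ).toLinearMap :=
        Submodule.mem_iSup_of_mem β ⟨g, rfl⟩
      exact (Submodule.mem_orthogonal' _ _).1 hv _ h1
    exact inner_self_eq_zero.1 (congrArg (fun R : _ →L[ℂ] ℂ => R v) this)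

/-- The unitary operator from `ℓ²(B) ⊗ H` onto `ℓ²(B; H)`. -/
def coords (B H : Type*) [DecidableEq B] [NormedAddCommGroup H] [InnerProductSpace ℂ H]
    [CompleteSpace H] :
    HilbertTensor (lp (fun _ : B => ℂ) 2) H ≃ₗᵢ[ℂ] lp (fun _ : B => H) 2 :=
  isHilbertSum_singleTmul.linearIsometryEquiv

lemma inner_tmul_single [CompleteSpace H] (β : B) (g : H)
    (v : HilbertTensor (lp (fun _ : B => ℂ) 2) H) :
    inner ℂ (tmul (lp.single 2 β (1 : ℂ)) g) v = inner ℂ g (coords B H v β) := by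
  have h : (coords B H).symm (lp.single 2 β g) = tmul (lp.single 2 β (1 : ℂ)) g :=
    isHilbertSum_singleTmul.linearIsometryEquiv_symm_apply_single g
  rw [← h, ← LinearIsometryEquiv.inner_map_map (coords B H), LinearIsometryEquiv.apply_symm_apply,
    lp.inner_single_left]

/-- The coordinate `v ↦ v_β` of a vector of `ℓ²(B) ⊗ H`. -/
def coord [CompleteSpace H] (β : B) : HilbertTensor (lp (fun _ : B => ℂ) 2) H →L[ℂ] H :=
  ContinuousLinearMap.adjoint (singleTmul H β).toContinuousLinearMap

lemma coord_apply [CompleteSpace H] (β : B) (v : HilbertTensor (lp (fun _ : B => ℂ) 2) H) :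
    coord β v = coords B H v β := by
  refine ext_inner_left ℂ fun g => ?_
  rw [coord, ContinuousLinearMap.adjoint_inner_right, ← inner_tmul_single]
  rfl

end HilbertTensor

end Coordinates

open HilbertTensor

/-! ### The universal model -/

section Words

variable {k : ℕ} {n : Fin k → ℕ}
variable {K : Type*} [NormedAddCommGroup K] [InnerProductSpace ℂ K]

lemma multiWordOp_one (A : ∀ i, Fin (n i) → K →L[ℂ] K) : multiWordOp A 1 = 1 := by
  refine List.prod_eq_one fun T hT => ?_
  obtain ⟨i, rfl⟩ := List.mem_ofFn.1 hT
  exact wordOp_one _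

lemma multiWordOp_consAt {A : ∀ i, Fin (n i) → K →L[ℂ] K} (hA : IsCommutingTuple A) (i : Fin k)
    (j : Fin (n i)) (β : ∀ i, FreeMonoid (Fin (n i))) :
    multiWordOp A (consAt i j β) = A i j * multiWordOp A β := by
  have e : (fun t => wordOp (A t) (consAt i j β t)) =
      Function.update (fun t => wordOp (A t) (β t)) i (A i j * wordOp (A i) (β i)) := by
    funext t
    by_cases ht : t = i
    · subst ht
      rw [consAt, Function.update_self, Function.update_self, wordOp_mul, wordOp_of]
    · rw [consAt, Function.update_of_ne ht, Function.update_of_ne ht]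
  rw [multiWordOp, e]
  exact prod_ofFn_update _ i _ fun t ht => commute_wordOp (fun s => hA i t ht.ne' j s) _

end Words

section Model

variable {k : ℕ} {n : Fin k → ℕ} {f : ∀ i, PosRegular (n i)} {m : Fin k → ℕ}

/-- The weight of `𝐖_{i,j}` at `e_β` is the quotient of the numbers `√b_β` before and after adding
the letter `g_j`. -/
lemma weight_mul_sqrt_multiB (i : Fin k) (j : Fin (n i)) (β : ∀ i, FreeMonoid (Fin (n i))) :
    √((f i).b (m i) (β i)) / √((f i).b (m i) (FreeMonoid.of j * β i)) *
      √(multiB f m (consAt i j β)) = √(multiB f m β) := by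
  have h1 := Finset.mul_prod_erase Finset.univ (fun t => (f t).b (m t) (β t)) (Finset.mem_univ i)
  have h2 := Finset.mul_prod_erase Finset.univ (fun t => (f t).b (m t) (consAt i j β t))
    (Finset.mem_univ i)
  have h3 : ∏ t ∈ Finset.univ.erase i, (f t).b (m t) (consAt i j β t) =
      ∏ t ∈ Finset.univ.erase i, (f t).b (m t) (β t) :=
    Finset.prod_congr rfl fun t ht => by
      rw [consAt, Function.update_of_ne (Finset.ne_of_mem_erase ht)]
  have h4 : consAt i j β i = FreeMonoid.of j * β i := Function.update_self _ _ _
  rw [h3, h4] at h2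
  have hp := (f i).b_pos (m i) (FreeMonoid.of j * β i)
  rw [multiB, multiB, ← h1, ← h2, Real.sqrt_mul hp.le, Real.sqrt_mul ((f i).b_nonneg _ _)]
  have : √((f i).b (m i) (FreeMonoid.of j * β i)) ≠ 0 := (Real.sqrt_pos.2 hp).ne'
  field_simp

/-- Operators acting on different tensor factors commute: neither changes the weight of the
other. -/
lemma isCommutingTuple_universalW : IsCommutingTuple (universalW f m) := by
  intro p q hpq s t
  refine lp_clm_ext fun β => ?_
  change universalW f m p s (universalW f m q t (fockBasis β)) =
    universalW f m q t (universalW f m p s (fockBasis β))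
  have h1 : consAt p s (consAt q t β) = consAt q t (consAt p s β) := by
    rw [consAt, consAt, consAt, consAt, Function.update_of_ne hpq, Function.update_of_ne hpq.symm,
      Function.update_comm hpq]
  have h2 : consAt q t β p = β p := Function.update_of_ne hpq _ _
  have h3 : consAt p s β q = β q := Function.update_of_ne hpq.symm _ _
  simp only [universalW_fockBasis, map_smul, h1, h2, h3, smul_smul]
  rw [mul_comm]

variable {Qs : Set (NCPoly n)}

/-- `M_Q` is invariant under the operators `𝐖_{i,j}`. -/
lemma universalW_mem_spaceM (i : Fin k) (j : Fin (n i)) {x : Fock n} (hx : x ∈ spaceM f m Qs) :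
    universalW f m i j x ∈ spaceM f m Qs := by
  have h : spaceM f m Qs ≤ (spaceM f m Qs).comap (universalW f m i j).toLinearMap := by
    refine Submodule.topologicalClosure_minimal _ (Submodule.span_le.2 ?_)
      ((Submodule.isClosed_topologicalClosure _).preimage (universalW f m i j).continuous)
    rintro _ ⟨α, β, q, hq, rfl⟩
    refine Submodule.le_topologicalClosure _ (Submodule.subset_span ⟨consAt i j α, β, q, hq, ?_⟩)
    rw [multiWordOp_consAt isCommutingTuple_universalW]
    rfl
  exact h hx

/-- As `M_Q` is invariant under `𝐖_{i,j}`, the operator `𝐒_{i,j}^*` is the restriction of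
`𝐖_{i,j}^*` to `N_Q`. -/
lemma subtypeL_comp_adjoint_universalS (i : Fin k) (j : Fin (n i)) :
    (spaceN f m Qs).subtypeL ∘L ContinuousLinearMap.adjoint (universalS f m Qs i j) =
      ContinuousLinearMap.adjoint (universalW f m i j) ∘L (spaceN f m Qs).subtypeL := by
  rw [universalS, ContinuousLinearMap.adjoint_comp, ContinuousLinearMap.adjoint_comp,
    Submodule.adjoint_subtypeL, Submodule.adjoint_orthogonalProjectionOnto]
  ext1 x
  have hx : ContinuousLinearMap.adjoint (universalW f m i j) x ∈ spaceN f m Qs := by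
    refine (Submodule.mem_orthogonal _ _).2 fun y hy => ?_
    rw [ContinuousLinearMap.adjoint_inner_right]
    exact (Submodule.mem_orthogonal _ _).1 x.2 _ (universalW_mem_spaceM i j hy)
  exact Submodule.starProjection_eq_self_iff.2 hx

variable {H : Type*} [NormedAddCommGroup H] [InnerProductSpace ℂ H]

/-- An operator `L` on `F² ⊗ H` with `L (𝐖_{i,j} ⊗ I) = A_{i,j} L` for all `i`, `j` vanishes on
`M_Q ⊗ H` if all polynomials in `Q` vanish at `A`. -/
lemma apply_tmul_eq_zero {A : ∀ i, Fin (n i) → H →L[ℂ] H}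
    (hQ : ∀ q ∈ Qs, polyEval q A = 0)
    {L : HilbertTensor (Fock n) H →L[ℂ] H}
    (hL : ∀ i j x g, L (tmul (universalW f m i j x) g) = A i j (L (tmul x g)))
    {x : Fock n} (hx : x ∈ spaceM f m Qs) (g : H) : L (tmul x g) = 0 := by
  have hword : ∀ i α x, L (tmul (wordOp (universalW f m i) α x) g) =
      wordOp (A i) α (L (tmul x g)) := by
    intro i α
    induction α using FreeMonoid.inductionOn' with
    | one => intro x; rw [wordOp_one, wordOp_one]; rfl
    | of_mul j α ih =>
      intro x
      rw [wordOp_mul, wordOp_of, wordOp_mul, wordOp_of, mul_apply_eq_comp, hL, ih]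
      rfl
  have hmulti : ∀ α x, L (tmul (multiWordOp (universalW f m) α x) g) =
      multiWordOp A α (L (tmul x g)) := by
    intro α
    have : ∀ l : List (Fin k), ∀ x,
        L (tmul ((l.map fun i => wordOp (universalW f m i) (α i)).prod x) g) =
          (l.map fun i => wordOp (A i) (α i)).prod (L (tmul x g)) := by
      intro l
      induction l with
      | nil => intro x; rfl
      | cons i l ih =>
        intro x
        rw [List.map_cons, List.prod_cons, List.map_cons, List.prod_cons, mul_apply_eq_comp, hword,
          ih]
        rfl
    intro x
    have h := this (List.finRange k) x
    rwa [← List.ofFn_eq_map, ← List.ofFn_eq_map] at h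
  have hpoly : ∀ q x, L (tmul (polyEval q (universalW f m) x) g) =
      polyEval q A (L (tmul x g)) := by
    intro q x
    simp only [polyEval, Finsupp.sum, _root_.sum_apply, map_sum,
      _root_.smul_apply, map_smul, hmulti]
  have h : spaceM f m Qs ≤ LinearMap.ker (L ∘L tmul.flip g).toLinearMap := by
    refine Submodule.topologicalClosure_minimal _ (Submodule.span_le.2 ?_)
      (L ∘L tmul.flip g).isClosed_ker
    rintro _ ⟨α, β, q, hq, rfl⟩
    change L (tmul (multiWordOp _ α (polyEval q _ (multiWordOp _ β (fockBasis 1)))) g) = 0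
    rw [hmulti, hpoly, hQ q hq]
    simp
  exact h hx

end Model

/-! ### The Berezin kernel -/

section Berezin

variable {H : Type*} [NormedAddCommGroup H] [InnerProductSpace ℂ H] [CompleteSpace H]
variable {k : ℕ} {n : Fin k → ℕ} {f : ∀ i, PosRegular (n i)} {m : Fin k → ℕ}
variable {A : ∀ i, Fin (n i) → H →L[ℂ] H} {Qs : Set (NCPoly n)}

/-- The Berezin kernel `V x = ∑_β √b_β e_β ⊗ S A_β^* x`. Its norm is given by the form of the sum
`T` of the series for `S^* S`. -/
lemma exists_berezinKernel (hm : ∀ i, 1 ≤ m i) (S : H →L[ℂ] H) {T : H →L[ℂ] H} {b : ℝ}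
    (hb : 0 ≤ b) (hT : 0 ≤ T) (hTb : T ≤ (b : ℂ) • (1 : H →L[ℂ] H))
    (hTS : quadForm T = FormOp.geomProd (cpForms f A) m
      (quadForm (ContinuousLinearMap.adjoint S * S))) :
    ∃ V : H →L[ℂ] HilbertTensor (Fock n) H,
      (∀ β x, coord β (V x) =
        (√(multiB f m β) : ℂ) • S (ContinuousLinearMap.adjoint (multiWordOp A β) x)) ∧
      ∀ x, ENNReal.ofReal (‖V x‖ ^ 2) = quadForm T x := by
  have hterm : ∀ β x, ENNReal.ofReal (‖((√(multiB f m β) : ℂ) •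
      S ∘L ContinuousLinearMap.adjoint (multiWordOp A β)) x‖ ^ 2) = ENNReal.ofReal (multiB f m β *
        ‖S (ContinuousLinearMap.adjoint (multiWordOp A β) x)‖ ^ 2) := by
    intro β x
    rw [_root_.smul_apply, norm_smul, mul_pow, Complex.norm_real, Real.norm_eq_abs, sq_abs,
      Real.sq_sqrt (multiB_pos f m β).le]
    rfl
  have hsum : ∀ x, ∑' β, ENNReal.ofReal (‖((√(multiB f m β) : ℂ) •
      S ∘L ContinuousLinearMap.adjoint (multiWordOp A β)) x‖ ^ 2) = quadForm T x := by
    intro x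
    rw [hTS, geomProd_quadForm hm]
    exact tsum_congr fun β => hterm β x
  obtain ⟨K, hK⟩ := exists_column (fun β => (√(multiB f m β) : ℂ) •
    S ∘L ContinuousLinearMap.adjoint (multiWordOp A β)) hb fun x => by
      rw [hsum]
      exact (le_smul_one_iff hb hT).1 hTb x
  refine ⟨(coords _ H).symm.toContinuousLinearEquiv.toContinuousLinearMap ∘L K, fun β x => ?_,
    fun x => ?_⟩
  · rw [coord_apply]
    change coords _ H ((coords _ H).symm (K x)) β = _
    rw [LinearIsometryEquiv.apply_symm_apply, hK]
    rfl
  · change ENNReal.ofReal (‖(coords _ H).symm (K x)‖ ^ 2) = _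
    rw [LinearIsometryEquiv.norm_map, ofReal_norm_sq_lp, ← hsum]
    exact tsum_congr fun β => by rw [hK]

/-- The Berezin kernel intertwines `A_{i,j}^*` with `𝐖_{i,j}^* ⊗ I`. -/
lemma adjoint_berezinKernel_universalW (hcomm : IsCommutingTuple A) {S : H →L[ℂ] H}
    {V : H →L[ℂ] HilbertTensor (Fock n) H}
    (hV : ∀ β x, coord β (V x) =
      (√(multiB f m β) : ℂ) • S (ContinuousLinearMap.adjoint (multiWordOp A β) x))
    (i : Fin k) (j : Fin (n i)) :
    ContinuousLinearMap.adjoint V ∘L map H (universalW f m i j) =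
      A i j ∘L ContinuousLinearMap.adjoint V := by
  have hL : ∀ β g, ContinuousLinearMap.adjoint V (tmul (fockBasis β) g) =
      (√(multiB f m β) : ℂ) • multiWordOp A β (ContinuousLinearMap.adjoint S g) := by
    intro β g
    refine ext_inner_right ℂ fun x => ?_
    rw [ContinuousLinearMap.adjoint_inner_left, fockBasis, inner_tmul_single, ← coord_apply, hV,
      inner_smul_left, inner_smul_right, Complex.conj_ofReal,
      ← ContinuousLinearMap.adjoint_inner_left, ContinuousLinearMap.adjoint_inner_right]
  refine clm_ext_single fun β g => ?_
  change ContinuousLinearMap.adjoint V (map H (universalW f m i j) (tmul (fockBasis β) g)) =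
    A i j (ContinuousLinearMap.adjoint V (tmul (fockBasis β) g))
  rw [map_tmul, universalW_fockBasis, map_smul, _root_.smul_apply, map_smul, hL, hL,
    multiWordOp_consAt hcomm, smul_smul, ← Complex.ofReal_mul, weight_mul_sqrt_multiB, map_smul]
  rfl

/-- An operator that is bounded above and below is an isomorphism onto its range. -/
lemma exists_equiv_range {E : Type*} [NormedAddCommGroup E] [NormedSpace ℂ E] (K : H →L[ℂ] E)
    {c d : ℝ} (hc : 0 < c) (hd : 0 ≤ d) (hK : ∀ x, c * ‖x‖ ≤ ‖K x‖) (hK' : ∀ x, ‖K x‖ ≤ d * ‖x‖) :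
    ∃ (G : Submodule ℂ E) (Y : H ≃L[ℂ] G), IsClosed (G : Set E) ∧ (∀ x, (Y x : E) = K x) ∧
      ‖(Y : H →L[ℂ] G)‖ * ‖(Y.symm : G →L[ℂ] H)‖ ≤ d / c := by
  have hKinv : ∀ x, ‖x‖ ≤ c⁻¹ * ‖K x‖ := by
    intro x
    rw [inv_mul_eq_div, le_div_iff₀ hc, mul_comm]
    exact hK x
  have hanti : AntilipschitzWith (Real.toNNReal c⁻¹) K :=
    K.antilipschitz_of_bound fun x => by
      rw [Real.coe_toNNReal _ (by positivity)]
      exact hKinv x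
  let Y₀ : H ≃ₗ[ℂ] LinearMap.range K.toLinearMap :=
    LinearEquiv.ofInjective K.toLinearMap hanti.injective
  let Y : H ≃L[ℂ] LinearMap.range K.toLinearMap :=
    Y₀.toContinuousLinearEquivOfBounds d c⁻¹ hK' fun y => by
      obtain ⟨x, rfl⟩ := Y₀.surjective y
      rw [LinearEquiv.symm_apply_apply]
      exact hKinv x
  refine ⟨_, Y, hanti.isClosed_range K.uniformContinuous, fun x => rfl, ?_⟩
  have h1 : ‖(Y : H →L[ℂ] LinearMap.range K.toLinearMap)‖ ≤ d :=
    ContinuousLinearMap.opNorm_le_bound _ hd hK'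
  have h2 : ‖(Y.symm : LinearMap.range K.toLinearMap →L[ℂ] H)‖ ≤ c⁻¹ := by
    refine ContinuousLinearMap.opNorm_le_bound _ (by positivity) fun y => ?_
    obtain ⟨x, rfl⟩ := Y.surjective y
    rw [ContinuousLinearEquiv.coe_coe, Y.symm_apply_apply]
    exact hKinv x
  rw [div_eq_mul_inv]
  exact mul_le_mul h1 h2 (ContinuousLinearMap.opNorm_nonneg _) hd

/-- The values of a Berezin kernel lie in `N_Q ⊗ H`, because its adjoint vanishes on `M_Q ⊗ H`.
As a map into this space it intertwines `A_{i,j}^*` with `𝐒_{i,j}^* ⊗ I`. -/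
lemma exists_compressedKernel (hcomm : IsCommutingTuple A) (hQ : ∀ q ∈ Qs, polyEval q A = 0)
    {S : H →L[ℂ] H} {V : H →L[ℂ] HilbertTensor (Fock n) H}
    (hV : ∀ β x, coord β (V x) =
      (√(multiB f m β) : ℂ) • S (ContinuousLinearMap.adjoint (multiWordOp A β) x)) :
    ∃ K : H →L[ℂ] HilbertTensor (spaceN f m Qs) H, (∀ x, ‖K x‖ = ‖V x‖) ∧
      ∀ i j x, tensorId H (ContinuousLinearMap.adjoint (universalS f m Qs i j)) (K x) =
        K (ContinuousLinearMap.adjoint (A i j) x) := by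
  have hVW := adjoint_berezinKernel_universalW hcomm hV
  let N := spaceN f m Qs
  let P : Fock n →L[ℂ] N := N.orthogonalProjectionOnto
  have hP : ContinuousLinearMap.adjoint P = N.subtypeL :=
    Submodule.adjoint_orthogonalProjectionOnto N
  have hι : ContinuousLinearMap.adjoint N.subtypeL = P := Submodule.adjoint_subtypeL N
  have hVN : ∀ x, map H N.subtypeL (map H P (V x)) = V x := by
    have h1 : ContinuousLinearMap.adjoint V ∘L map H (N.subtypeL ∘L P) =
        ContinuousLinearMap.adjoint V := by
      refine clm_ext fun x g => ?_
      have h2 : x - N.subtypeL (P x) ∈ spaceM f m Qs := by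
        have h3 : x - N.subtypeL (P x) ∈ Nᗮ := N.sub_starProjection_mem_orthogonal x
        have h4 : Nᗮ = spaceM f m Qs :=
          (Submodule.orthogonal_orthogonal_eq_closure _).trans
            (Submodule.isClosed_topologicalClosure _).submodule_topologicalClosure_eq
        exact h4 ▸ h3
      have h5 := apply_tmul_eq_zero hQ (L := ContinuousLinearMap.adjoint V)
        (fun i j x g => by
          rw [← map_tmul]
          exact congrArg (fun B : HilbertTensor (Fock n) H →L[ℂ] H => B (tmul x g)) (hVW i j)) h2 g
      rw [map_sub, _root_.sub_apply, map_sub, sub_eq_zero] at h5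
      rw [ContinuousLinearMap.comp_apply, map_tmul, h5]
      rfl
    intro x
    rw [HilbertTensor.map_map]
    have h2 := congrArg ContinuousLinearMap.adjoint h1
    rw [ContinuousLinearMap.adjoint_comp, adjoint_map, ContinuousLinearMap.adjoint_comp,
      ContinuousLinearMap.adjoint_adjoint, hP, hι] at h2
    exact congrArg (fun B : H →L[ℂ] HilbertTensor (Fock n) H => B x) h2
  refine ⟨map H P ∘L V, fun x => ?_, fun i j x => ?_⟩
  · rw [← hVN x, norm_map_subtypeL]
    rfl
  · have h1 : map H (ContinuousLinearMap.adjoint (universalW f m i j)) (V x) =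
        V (ContinuousLinearMap.adjoint (A i j) x) := by
      have h2 := congrArg ContinuousLinearMap.adjoint (hVW i j)
      rw [ContinuousLinearMap.adjoint_comp, ContinuousLinearMap.adjoint_comp, adjoint_map,
        ContinuousLinearMap.adjoint_adjoint] at h2
      exact congrArg (fun B : H →L[ℂ] HilbertTensor (Fock n) H => B x) h2
    have h3 : ContinuousLinearMap.adjoint (universalS f m Qs i j) =
        P ∘L ContinuousLinearMap.adjoint (universalW f m i j) ∘L N.subtypeL := by
      rw [universalS, ContinuousLinearMap.adjoint_comp, ContinuousLinearMap.adjoint_comp,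
        Submodule.adjoint_orthogonalProjectionOnto, Submodule.adjoint_subtypeL]
      rfl
    change map H (ContinuousLinearMap.adjoint (universalS f m Qs i j)) (map H P (V x)) =
      map H P (V (ContinuousLinearMap.adjoint (A i j) x))
    rw [h3, ← HilbertTensor.map_map, ← HilbertTensor.map_map, hVN, h1]

/-- A solution of the two-sided estimate makes `A` similar to a part of the model, with control on
the similarity: the similarity is the Berezin kernel, whose values lie in `N_Q ⊗ H`. -/
lemma exists_isSimilarToPart (hm : ∀ i, 1 ≤ m i) (hcomm : IsCommutingTuple A)
    (hconv : ∀ i, IsWeaklyConvergent (f i) (A i)) (hQ : ∀ q ∈ Qs, polyEval q A = 0)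
    {a b : ℝ} (ha : 0 < a) (hab : a ≤ b) {R : H →L[ℂ] H} (hR : 0 ≤ R)
    (h : SeriesBetween (cpTuple f A) m R a b) :
    ∃ (G : Submodule ℂ (HilbertTensor (spaceN f m Qs) H)) (Y : H ≃L[ℂ] G),
      IsSimilarToPart f m Qs A G Y ∧
      ‖(Y : H →L[ℂ] G)‖ * ‖(Y.symm : G →L[ℂ] H)‖ ≤ √(b / a) := by
  have hb : 0 ≤ b := ha.le.trans hab
  obtain ⟨T, hT, haT, hTb⟩ := h
  obtain ⟨hT0, hTq⟩ := (hasSum_series_iff hm hconv hR).1 hT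
  obtain ⟨S, rfl, -⟩ := exists_adjoint_mul_self hR
  obtain ⟨V, hV, hVnorm⟩ := exists_berezinKernel hm S hb hT0 hTb hTq
  obtain ⟨K, hKV, hKS⟩ := exists_compressedKernel (Qs := Qs) hcomm hQ hV
  obtain ⟨hKge, hKle⟩ := norm_bounds_of_quadForm (K := K) ha.le hb hT0 haT hTb fun x => by
    rw [hKV, hVnorm]
  obtain ⟨G, Y, hclosed, hY, hnorm⟩ :=
    exists_equiv_range K (Real.sqrt_pos.2 ha) (Real.sqrt_nonneg b) hKge hKle
  have hYS : ∀ i j x, tensorId H (ContinuousLinearMap.adjoint (universalS f m Qs i j)) (Y x : G) =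
      (Y (ContinuousLinearMap.adjoint (A i j) x) : G) := by
    intro i j x
    rw [hY, hY]
    exact hKS i j x
  have hG : ∀ i j, ∀ y ∈ G,
      tensorId H (ContinuousLinearMap.adjoint (universalS f m Qs i j)) y ∈ G := by
    intro i j y hy
    obtain ⟨x, hx⟩ := Y.surjective ⟨y, hy⟩
    have h1 := hYS i j x
    rw [hx] at h1
    rw [h1]
    exact Subtype.prop _
  refine ⟨G, Y, ⟨hclosed, hG, fun i j => ?_⟩, ?_⟩
  · ext x
    change _ = Y.symm _
    rw [ContinuousLinearEquiv.eq_symm_apply]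
    exact Subtype.ext (hYS i j x).symm
  · rw [Real.sqrt_div hb]
    exact hnorm

/-- If `A` is similar to a part of the model, then the vacuum component of the similarity yields a
solution of the two-sided estimate. -/
lemma exists_seriesBetween_of_isSimilarToPart (hm : ∀ i, 1 ≤ m i) (hcomm : IsCommutingTuple A)
    (hconv : ∀ i, IsWeaklyConvergent (f i) (A i))
    {G : Submodule ℂ (HilbertTensor (spaceN f m Qs) H)} {Y : H ≃L[ℂ] G}
    (h : IsSimilarToPart f m Qs A G Y) :
    ∃ a b : ℝ, 0 < a ∧ a ≤ b ∧ ∃ R : H →L[ℂ] H, 0 ≤ R ∧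
      SeriesBetween (cpTuple f A) m R a b := by
  obtain ⟨-, hG, hA⟩ := h
  let N := spaceN f m Qs
  let V : H →L[ℂ] HilbertTensor (Fock n) H :=
    map H N.subtypeL ∘L G.subtypeL ∘L (Y : H →L[ℂ] G)
  have hVnorm : ∀ x, ‖V x‖ = ‖Y x‖ := fun x => norm_map_subtypeL N _
  have hVA : ∀ i j x, V (ContinuousLinearMap.adjoint (A i j) x) =
      map H (ContinuousLinearMap.adjoint (universalW f m i j)) (V x) := by
    intro i j x
    have h1 : ((Y (ContinuousLinearMap.adjoint (A i j) x) : G) : HilbertTensor N H) =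
        map H (ContinuousLinearMap.adjoint (universalS f m Qs i j)) (Y x) := by
      rw [hA i j]
      exact congrArg Subtype.val (Y.apply_symm_apply _)
    change map H N.subtypeL (Y (ContinuousLinearMap.adjoint (A i j) x) : G) =
      map H (ContinuousLinearMap.adjoint (universalW f m i j)) (map H N.subtypeL (Y x : G))
    rw [h1, HilbertTensor.map_map, HilbertTensor.map_map, subtypeL_comp_adjoint_universalS]
  have hstep : ∀ i j β x, coord β (V (ContinuousLinearMap.adjoint (A i j) x)) =
      ((√((f i).b (m i) (β i)) / √((f i).b (m i) (FreeMonoid.of j * β i)) : ℝ) : ℂ) •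
        coord (consAt i j β) (V x) := by
    intro i j β x
    refine ext_inner_left ℂ fun g => ?_
    rw [coord_apply, coord_apply, ← inner_tmul_single, hVA, ← adjoint_map,
      ContinuousLinearMap.adjoint_inner_right, inner_smul_right, ← inner_tmul_single]
    change inner ℂ (map H (universalW f m i j) (tmul (fockBasis β) g)) _ =
      _ * inner ℂ (tmul (fockBasis (consAt i j β)) g) _
    rw [map_tmul, universalW_fockBasis, map_smul, _root_.smul_apply, inner_smul_left,
      Complex.conj_ofReal]
  have hpos : ∀ β, 0 < √(multiB f m β) := fun β => Real.sqrt_pos.2 (multiB_pos f m β)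
  let S : H →L[ℂ] H := ((√(multiB f m 1))⁻¹ : ℂ) • coord 1 ∘L V
  -- The recursion for the coordinates of `V` forces them to be those of a Berezin kernel.
  have hcoord : ∀ β x, coord β (V x) =
      (√(multiB f m β) : ℂ) • S (ContinuousLinearMap.adjoint (multiWordOp A β) x) := by
    intro β
    induction β using multiWord_induction with
    | h1 =>
      intro x
      rw [multiWordOp_one, ← ContinuousLinearMap.star_eq_adjoint, star_one]
      change _ = (√(multiB f m 1) : ℂ) • ((√(multiB f m 1))⁻¹ : ℂ) • coord 1 (V x)
      rw [smul_smul, mul_inv_cancel₀ (Complex.ofReal_ne_zero.2 (hpos 1).ne'), one_smul]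
    | hc i j β ih =>
      intro x
      have h1 := hstep i j β x
      have hadj : ContinuousLinearMap.adjoint (multiWordOp A (consAt i j β)) x =
          ContinuousLinearMap.adjoint (multiWordOp A β)
            (ContinuousLinearMap.adjoint (A i j) x) := by
        rw [multiWordOp_consAt hcomm, ← ContinuousLinearMap.star_eq_adjoint, star_mul]
        rfl
      rw [ih, ← hadj, ← weight_mul_sqrt_multiB i j β, Complex.ofReal_mul, mul_smul] at h1
      have hw : ((√((f i).b (m i) (β i)) / √((f i).b (m i) (FreeMonoid.of j * β i)) : ℝ) : ℂ) ≠ 0 :=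
        Complex.ofReal_ne_zero.2 (div_pos (Real.sqrt_pos.2 ((f i).b_pos _ _))
          (Real.sqrt_pos.2 ((f i).b_pos _ _))).ne'
      exact (smul_right_injective H hw h1).symm
  let T : H →L[ℂ] H := ContinuousLinearMap.adjoint V ∘L V
  have hT : 0 ≤ T := (ContinuousLinearMap.nonneg_iff_isPositive _).2
    (ContinuousLinearMap.isPositive_adjoint_comp_self V)
  have hTV : ∀ x, quadForm T x = ENNReal.ofReal (‖V x‖ ^ 2) := by
    intro x
    rw [quadForm, ContinuousLinearMap.comp_apply, ContinuousLinearMap.adjoint_inner_right,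
      inner_self_eq_norm_sq_to_K]
    norm_cast
  have hTS : quadForm T = FormOp.geomProd (cpForms f A) m
      (quadForm (ContinuousLinearMap.adjoint S * S)) := by
    funext x
    rw [hTV, geomProd_quadForm hm, ← LinearIsometryEquiv.norm_map (coords _ H), ofReal_norm_sq_lp]
    refine tsum_congr fun β => ?_
    rw [← coord_apply, hcoord, norm_smul, mul_pow, Complex.norm_real, Real.norm_eq_abs, sq_abs,
      Real.sq_sqrt (multiB_pos f m β).le]
  have hu : IsUnit T := by
    set c := ‖(Y.symm : G →L[ℂ] H)‖ + 1
    have hc : 0 < c := by positivity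
    refine isUnit_of_smul_one_le (a := (c ^ 2)⁻¹) (by positivity)
      ((smul_one_le_iff (by positivity) hT).2 fun x => ?_) hT
    rw [hTV]
    refine ENNReal.ofReal_le_ofReal ?_
    rw [inv_mul_le_iff₀ (by positivity), ← mul_pow, hVnorm]
    refine pow_le_pow_left₀ (norm_nonneg _) ?_ 2
    calc ‖x‖ = ‖(Y.symm : G →L[ℂ] H) (Y x)‖ := by
          rw [ContinuousLinearEquiv.coe_coe, Y.symm_apply_apply]
      _ ≤ ‖(Y.symm : G →L[ℂ] H)‖ * ‖Y x‖ := ContinuousLinearMap.le_opNorm _ _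
      _ ≤ c * ‖Y x‖ := by gcongr; simp [c]
  obtain ⟨a, b, ha, hab, h1, h2⟩ := exists_bounds_of_isUnit hT hu
  have hR : 0 ≤ ContinuousLinearMap.adjoint S * S :=
    (ContinuousLinearMap.nonneg_iff_isPositive _).2
      (ContinuousLinearMap.isPositive_adjoint_comp_self S)
  exact ⟨a, b, ha, hab, _, hR, T, (hasSum_series_iff hm hconv hR).2 ⟨hT, hTS⟩, h1, h2⟩

end Berezin

end NCVariety

end

theorem mainTheorem1 {k : ℕ} {n m : Fin k → ℕ} (hm : ∀ i, 1 ≤ m i)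
    (f : ∀ i, NCVariety.PosRegular (n i)) (Qs : Set (NCVariety.NCPoly n))
    {H : Type*} [NormedAddCommGroup H] [InnerProductSpace ℂ H] [CompleteSpace H]
    (A : ∀ i, Fin (n i) → H →L[ℂ] H)
    (hcomm : NCVariety.IsCommutingTuple A)
    (hconv : ∀ i, NCVariety.IsWeaklyConvergent (f i) (A i))
    (hQ : ∀ q ∈ Qs, NCVariety.polyEval q A = 0) :
    [∃ (G : Submodule ℂ (NCVariety.HilbertTensor (NCVariety.spaceN f m Qs) H)) (Y : H ≃L[ℂ] G),
        NCVariety.IsSimilarToPart f m Qs A G Y,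
      ∃ Q ∈ NCVariety.posCone (NCVariety.cpTuple f A) m, IsUnit Q ∧
        ∀ i, Tendsto (fun s : ℕ => ContinuousLinearMapWOT.ofCLM
          ((NCVariety.cpTuple f A i)^[s] Q)) atTop (𝓝 0),
      ∃ a b : ℝ, 0 < a ∧ a ≤ b ∧ ∃ R : H →L[ℂ] H, 0 ≤ R ∧
        NCVariety.SeriesBetween (NCVariety.cpTuple f A) m R a b].TFAE ∧
    ∀ a b : ℝ, 0 < a → a ≤ b → ∀ R : H →L[ℂ] H, 0 ≤ R →
      NCVariety.SeriesBetween (NCVariety.cpTuple f A) m R a b →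
      ∃ (G : Submodule ℂ (NCVariety.HilbertTensor (NCVariety.spaceN f m Qs) H)) (Y : H ≃L[ℂ] G),
        NCVariety.IsSimilarToPart f m Qs A G Y ∧
        ‖(Y : H →L[ℂ] G)‖ * ‖(Y.symm : G →L[ℂ] H)‖ ≤ √(b / a) := by
  have h31 := fun a b (ha : 0 < a) (hab : a ≤ b) R (hR : 0 ≤ R) h =>
    NCVariety.exists_isSimilarToPart (Qs := Qs) (a := a) (b := b) (R := R) hm hcomm hconv hQ ha hab
      hR h
  refine ⟨?_, h31⟩
  tfae_have 1 → 3 := fun ⟨G, Y, h⟩ =>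
    NCVariety.exists_seriesBetween_of_isSimilarToPart hm hcomm hconv h
  tfae_have 3 → 1 := fun ⟨a, b, ha, hab, R, hR, h⟩ => by
    obtain ⟨G, Y, hGY, -⟩ := h31 a b ha hab R hR h
    exact ⟨G, Y, hGY⟩
  tfae_have 3 → 2 := fun ⟨a, b, ha, hab, R, hR, h⟩ =>
    NCVariety.exists_pure_of_seriesBetween hm hcomm hconv ha hR h
  tfae_have 2 → 3 := fun ⟨Q, hQ, hu, hpure⟩ =>
    NCVariety.exists_seriesBetween_of_pure hm hcomm hconv hQ hu hpure
  tfae_finish
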